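/- Let $d\ge 1$, let $\mathbb B=\{x\in\mathbb R^d:|x|\le 1\}$, and let $q\ge 4$ be an even integer. With $\widehat f(\xi)=\int_{\mathbb R^d}e^{-2\pi i x\cdot\xi}f(x)\,dx$, let $K_q$ and $L_q$ be the (real-valued) functions on $\mathbb R^d$ determined by $$\widehat{K_q}=|\widehat{1_{\mathbb B}}|^{q-2}\,\widehat{1_{\mathbb B}},\qquad \widehat{L_q}=|\widehat{1_{\mathbb B}}|^{q-2},$$ that is, the inverse Fourier transforms of the right-hand sides. Let $L^2(\mathbb B)$ be the Hilbert space of real-valued square-integrable functions on $\mathbb B$, and for $h\in L^2(\mathbb B)$ put $\tilde h(x)=h(-x)$. Let $\mathcal H\subset L^2(\mathbb B)$ be the subspace of the functions $K_q(x)^{1/2}(a\cdot x+b)$ with $a\in\mathbb R^d$, $b\in\mathbb R$, and let $P_{\mathcal H}$ be the orthogonal projection of $L^2(\mathbb B)$ onto $\mathcal H$. Then the formula $$T_qh=\Big.K_q^{-1/2}\big((K_q^{-1/2}h1_{\mathbb B})*L_q\big)\Big|_{\mathbb B}$$ defines a bounded, compact, self-adjoint operator $T_q$ on $L^2(\mathbb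 B)$, and, with $Q_q(f,h)=\langle f,T_qh\rangle$, there exists $c>0$, depending only on $d$ and $q$, such that for every $h\in L^2(\mathbb B)$ $$-\frac q2\|h\|_{L^2(\mathbb B)}^2-\frac14q(q-2)\,Q_q(h,\tilde h)+\frac14q^2\,Q_q(h,h)\le -c\,\|(I-P_{\mathcal H})h\|_{L^2(\mathbb B)}^2 .$$ -/

import Mathlib

open MeasureTheory
open scoped FourierTransform Convolution

noncomputable section

namespace BallSpectral

/-- `ℝ^d` with its Euclidean norm and Lebesgue measure. -/
abbrev Rd (d : ℕ) : Type := EuclideanSpace ℝ (Fin d)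

/-- The unit ball of `ℝ^d`. -/
def unitBall (d : ℕ) : Set (Rd d) := Metric.closedBall 0 1

/-- Lebesgue measure on the unit ball. -/
def ballMeasure (d : ℕ) : Measure (Rd d) := volume.restrict (unitBall d)

/-- The real Hilbert space `L²(𝔹)`. -/
abbrev L2Ball (d : ℕ) : Type := Lp ℝ 2 (ballMeasure d)

/-- The Fourier transform of the indicator function of the unit ball,
`ξ ↦ ∫_𝔹 e^{-2π i x·ξ} dx`. -/
def ballHat (d : ℕ) : Rd d → ℂ := 𝓕 ((unitBall d).indicator (fun _ => (1 : ℂ)))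

/-- The function `|1̂_𝔹|^{q-2} 1̂_𝔹`. -/
def KHat (d : ℕ) (q : ℝ) (ξ : Rd d) : ℂ :=
  ((‖ballHat d ξ‖ ^ (q - 2) : ℝ) : ℂ) * ballHat d ξ

/-- The function `|1̂_𝔹|^{q-2}`. -/
def LHat (d : ℕ) (q : ℝ) (ξ : Rd d) : ℂ := ((‖ballHat d ξ‖ ^ (q - 2) : ℝ) : ℂ)

/-- `K_q`, the inverse Fourier transform of `|1̂_𝔹|^{q-2} 1̂_𝔹`; that inverse transform is
real-valued (`ofReal_K`), so taking the real part only changes the codomain. -/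
def K (d : ℕ) (q : ℝ) (x : Rd d) : ℝ := (𝓕⁻ (KHat d q) x).re

/-- `L_q`, the inverse Fourier transform of `|1̂_𝔹|^{q-2}`; that inverse transform is
real-valued (`ofReal_L`), so taking the real part only changes the codomain. -/
def L (d : ℕ) (q : ℝ) (x : Rd d) : ℝ := (𝓕⁻ (LHat d q) x).re

theorem neg_mem_unitBall {d : ℕ} {x : Rd d} : -x ∈ unitBall d ↔ x ∈ unitBall d := by
  simp [unitBall]

theorem ballHat_neg (d : ℕ) (ξ : Rd d) : ballHat d (-ξ) = ballHat d ξ := by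
  unfold ballHat
  rw [Real.fourier_eq, Real.fourier_eq, ← integral_neg_eq_self]
  congr 1
  ext v
  simp only [inner_neg_neg]
  congr 1
  by_cases h : v ∈ unitBall d
  · rw [Set.indicator_of_mem h, Set.indicator_of_mem (neg_mem_unitBall.mpr h)]
  · rw [Set.indicator_of_notMem h, Set.indicator_of_notMem (mt neg_mem_unitBall.mp h)]

theorem conj_ballHat (d : ℕ) (ξ : Rd d) :
    (starRingEnd ℂ) (ballHat d ξ) = ballHat d ξ := by
  conv_rhs => rw [← ballHat_neg]
  unfold ballHat
  rw [Real.fourier_eq', Real.fourier_eq', ← integral_conj]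
  congr 1
  ext v
  by_cases h : v ∈ unitBall d <;> simp [h, ← Complex.exp_conj, Complex.conj_ofNat]

theorem conj_fourierInv {d : ℕ} (G : Rd d → ℂ) (hG : ∀ ξ, (starRingEnd ℂ) (G ξ) = G (-ξ))
    (x : Rd d) : (starRingEnd ℂ) (𝓕⁻ G x) = 𝓕⁻ G x := by
  rw [Real.fourierInv_eq', ← integral_conj, ← integral_neg_eq_self]
  congr 1
  ext v
  simp [hG, ← Complex.exp_conj, Complex.conj_ofNat]

theorem ofReal_K (d : ℕ) (q : ℝ) (x : Rd d) : (K d q x : ℂ) = 𝓕⁻ (KHat d q) x :=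
  Complex.conj_eq_iff_re.mp (conj_fourierInv _ (fun ξ => by
    simp only [KHat, map_mul, conj_ballHat, ballHat_neg, Complex.conj_ofReal]) x)

theorem ofReal_L (d : ℕ) (q : ℝ) (x : Rd d) : (L d q x : ℂ) = 𝓕⁻ (LHat d q) x :=
  Complex.conj_eq_iff_re.mp (conj_fourierInv _ (fun ξ => by
    simp only [LHat, ballHat_neg, Complex.conj_ofReal]) x)

theorem continuous_K (d : ℕ) (q : ℝ) : Continuous (K d q) := by
  unfold K
  refine Complex.continuous_re.comp ?_
  have he : 𝓕⁻ (KHat d q) = fun x => 𝓕 (KHat d q) (-x) :=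
    funext fun x => Real.fourierInv_eq_fourier_neg _ _
  rw [he]
  by_cases h : Integrable (KHat d q)
  · have hc : Continuous (𝓕 (KHat d q)) :=
      VectorFourier.fourierIntegral_continuous Real.continuous_fourierChar
        (L := innerₗ (Rd d)) continuous_inner h
    exact hc.comp continuous_neg
  · have h0 : ∀ x, 𝓕 (KHat d q) x = 0 := fun x => by
      rw [Real.fourier_eq]
      refine integral_undef ?_
      rwa [Real.fourierIntegral_convergent_iff]
    simp only [h0]
    exact continuous_const

instance instIsFiniteMeasureBallMeasure (d : ℕ) : IsFiniteMeasure (ballMeasure d) :=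
  ⟨by
    rw [ballMeasure, Measure.restrict_apply_univ]
    exact measure_closedBall_lt_top⟩

/-- The function `K_q(x)^{1/2} (a·x + b)`. -/
def affineFun (d : ℕ) (q : ℝ) (p : Rd d × ℝ) (x : Rd d) : ℝ :=
  √(K d q x) * (inner ℝ p.1 x + p.2)

theorem memLp_affineFun (d : ℕ) (q : ℝ) (p : Rd d × ℝ) :
    MemLp (affineFun d q p) 2 (ballMeasure d) := by
  have hc : Continuous (affineFun d q p) := by
    unfold affineFun
    have := continuous_K d q
    fun_prop
  obtain ⟨C, hC⟩ := (isCompact_closedBall (0 : Rd d) 1).exists_bound_of_continuousOn hc.continuousOn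
  refine MemLp.of_bound hc.aestronglyMeasurable C ?_
  exact (ae_restrict_iff' Metric.isClosed_closedBall.measurableSet).mpr (ae_of_all _ hC)

/-- The linear map sending `(a, b)` to the class of `K_q(x)^{1/2} (a·x + b)` in `L²(𝔹)`. -/
def affineMap (d : ℕ) (q : ℝ) : (Rd d × ℝ) →ₗ[ℝ] L2Ball d where
  toFun p := (memLp_affineFun d q p).toLp
  map_add' p p' := by
    rw [← MemLp.toLp_add]
    refine MemLp.toLp_congr _ _ (ae_of_all _ fun x => ?_)
    simp only [affineFun, Prod.fst_add, Prod.snd_add, inner_add_left, Pi.add_apply]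
    ring
  map_smul' c p := by
    rw [RingHom.id_apply, ← MemLp.toLp_const_smul]
    refine MemLp.toLp_congr _ _ (ae_of_all _ fun x => ?_)
    simp only [affineFun, Prod.smul_fst, Prod.smul_snd, inner_smul_left, Pi.smul_apply,
      smul_eq_mul, conj_trivial]
    ring

/-- The subspace `ℋ` of `L²(𝔹)` of the functions `K_q(x)^{1/2} (a·x + b)`, `a ∈ ℝ^d`, `b ∈ ℝ`. -/
def H (d : ℕ) (q : ℝ) : Submodule ℝ (L2Ball d) := LinearMap.range (affineMap d q)

instance instFiniteDimensionalH (d : ℕ) (q : ℝ) : FiniteDimensional ℝ (H d q) := by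
  unfold H
  infer_instance

theorem measurePreserving_neg_ball (d : ℕ) :
    MeasurePreserving (fun x : Rd d => -x) (ballMeasure d) (ballMeasure d) := by
  have h := (Measure.measurePreserving_neg (volume : Measure (Rd d))).restrict_preimage
    (s := unitBall d) Metric.isClosed_closedBall.measurableSet
  have h2 : Neg.neg ⁻¹' unitBall d = unitBall d := Set.ext fun x => neg_mem_unitBall
  rw [h2] at h
  exact h

/-- The reflection `h ↦ h̃`, `h̃(x) = h(-x)`, on `L²(𝔹)`. -/
def reflection (d : ℕ) (h : L2Ball d) : L2Ball d :=
  Lp.compMeasurePreserving (fun x : Rd d => -x) (measurePreserving_neg_ball d) h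

/-- The function `K_q^{-1/2} ((K_q^{-1/2} h 1_𝔹) ∗ L_q)`. -/
def TFun (d : ℕ) (q : ℝ) (h : Rd d → ℝ) (x : Rd d) : ℝ :=
  (√(K d q x))⁻¹ *
    (((unitBall d).indicator fun y => (√(K d q y))⁻¹ * h y)
      ⋆[ContinuousLinearMap.mul ℝ ℝ, volume] L d q) x

/-- `T` is the operator `T_q` on `L²(𝔹)`: for every `h`, the function `T h` is the restriction to `𝔹` of
`K_q^{-1/2} ((K_q^{-1/2} h 1_𝔹) ∗ L_q)`. There is at most one such `T`. -/
def IsT (d : ℕ) (q : ℝ) (T : L2Ball d →L[ℝ] L2Ball d) : Prop :=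
  ∀ h : L2Ball d, T h =ᵐ[ballMeasure d] TFun d q h

/-- The form `Q(f, h) = ⟨f, T h⟩` of an operator `T` on `L²(𝔹)`. -/
def Q {d : ℕ} (T : L2Ball d →L[ℝ] L2Ball d) (f h : L2Ball d) : ℝ := inner ℝ f (T h)

end BallSpectral

end

/-!
For even `q` both `K_q` and `L_q` are convolution powers of `1_𝔹`, with `q - 1` and `q - 2` factors,
so that `K_q = 1_𝔹 * L_q` is the `(q - 1)`-fold convolution power.  The form to be bounded is
`-(q/2) (‖h‖² - Q_q(h, h))` on even `h` and `-(q/2) (‖h‖² - (q - 1) Q_q(h, h))` on odd `h`, and the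
substitution `h = K_q^{1/2} f` removes the weights:

* `‖h‖² - Q_q(h, h) = ½ ∫_𝔹 ∫_𝔹 (f x - f y)² L_q(x - y)` for every `f`;
* `q (‖h‖² - (q - 1) Q_q(h, h)) = ∫ (∑ f(x_i) - f(∑ x_i))²` for odd `f`, where `x_1, …, x_{q-1}`
  range over the points of `𝔹` whose sum lies in `𝔹`; with `x_q = -∑ x_i` the integrand is the
  square of the sum of `f` over `q` points of `𝔹` with sum zero, in which all cross terms are alike.

Both are nonnegative; the first vanishes only for constant `f` and the second only for linear `f`.
Hence the operator acting as `T_q` on even and as `(q - 1) T_q` on odd functions is at most `1`,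
with eigenspace `ℋ` for the eigenvalue `1`, and since it is compact the rest of its spectrum stays
away from `1`.  The argument applies to every symmetric convex body.
-/

noncomputable section

namespace BallSpectral

open Filter Topology
open scoped Pointwise ContDiff SchwartzMap

/-! ### Bounded measurable functions -/

/-- Bounded measurable real-valued functions. -/
def BddMeas {α : Type*} [MeasurableSpace α] (F : α → ℝ) : Prop :=
  Measurable F ∧ ∃ C, ∀ x, ‖F x‖ ≤ C

namespace BddMeas

variable {α β : Type*} [MeasurableSpace α] [MeasurableSpace β] {F G : α → ℝ}

theorem const (c : ℝ) : BddMeas fun _ : α => c := ⟨measurable_const, ‖c‖, fun _ => le_rfl⟩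

theorem add (hF : BddMeas F) (hG : BddMeas G) : BddMeas fun x => F x + G x := by
  obtain ⟨hF, C, hC⟩ := hF
  obtain ⟨hG, D, hD⟩ := hG
  exact ⟨hF.add hG, C + D, fun x => (norm_add_le _ _).trans (add_le_add (hC x) (hD x))⟩

theorem mul (hF : BddMeas F) (hG : BddMeas G) : BddMeas fun x => F x * G x := by
  obtain ⟨hF, C, hC⟩ := hF
  obtain ⟨hG, D, hD⟩ := hG
  refine ⟨hF.mul hG, C * D, fun x => ?_⟩
  rw [norm_mul]
  exact mul_le_mul (hC x) (hD x) (norm_nonneg _) ((norm_nonneg _).trans (hC x))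

theorem sub (hF : BddMeas F) (hG : BddMeas G) : BddMeas fun x => F x - G x := by
  simpa [sub_eq_add_neg] using hF.add ((const (-1)).mul hG)

theorem pow (hF : BddMeas F) (n : ℕ) : BddMeas fun x => F x ^ n := by
  induction n with
  | zero => simpa using const 1
  | succ n ih => simpa [pow_succ] using ih.mul hF

theorem comp (hF : BddMeas F) {φ : β → α} (hφ : Measurable φ) : BddMeas fun x => F (φ x) :=
  ⟨hF.1.comp hφ, hF.2.imp fun _ hC _ => hC _⟩

theorem sum {ι : Type*} (s : Finset ι) {F : ι → α → ℝ} (hF : ∀ i, BddMeas (F i)) :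
    BddMeas fun x => ∑ i ∈ s, F i x := by
  classical
  induction s using Finset.induction_on with
  | empty => simpa using const 0
  | insert i s hi ih => simpa [Finset.sum_insert hi] using (hF i).add ih

theorem memLp (hF : BddMeas F) (p : ENNReal) (μ : Measure α) [IsFiniteMeasure μ] :
    MemLp F p μ := by
  obtain ⟨hF, C, hC⟩ := hF
  exact MemLp.of_bound hF.aestronglyMeasurable C (ae_of_all _ hC)

theorem integrable (hF : BddMeas F) (μ : Measure α) [IsFiniteMeasure μ] : Integrable F μ :=
  memLp_one_iff_integrable.mp (hF.memLp 1 μ)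

theorem integral_right {F : α × β → ℝ} (hF : BddMeas F) (μ : Measure β) [IsFiniteMeasure μ] :
    BddMeas fun x => ∫ y, F (x, y) ∂μ := by
  obtain ⟨hF, C, hC⟩ := hF
  exact ⟨hF.stronglyMeasurable.integral_prod_right'.measurable, C * μ.real Set.univ,
    fun x => norm_integral_le_of_norm_le_const (ae_of_all _ fun y => hC (x, y))⟩

end BddMeas

section Plancherel

variable {V F : Type*} [NormedAddCommGroup V] [InnerProductSpace ℝ V] [FiniteDimensional ℝ V]
  [MeasurableSpace V] [BorelSpace V] [NormedAddCommGroup F] [InnerProductSpace ℂ F]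
  [CompleteSpace F]

theorem integral_fourier_smul_eq_flip {g : V → ℂ} {f : V → F} (hg : Integrable g)
    (hf : Integrable f) : ∫ ξ, 𝓕 g ξ • f ξ = ∫ x, g x • 𝓕 f x := by
  have h := VectorFourier.integral_fourierIntegral_smul_eq_flip (L := innerₗ V)
    Real.continuous_fourierChar continuous_inner hg hf
  rwa [flip_innerₗ] at h

theorem fourier_toLp_two_ae_eq {f : V → F} (h₁ : Integrable f) (h₂ : MemLp f 2) :
    (𝓕 (h₂.toLp f) : Lp F 2 (volume : Measure V)) =ᵐ[volume] 𝓕 f := by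
  set u : Lp F 2 (volume : Measure V) := 𝓕 (h₂.toLp f) with hu
  have hcont : Continuous (𝓕 f) := VectorFourier.fourierIntegral_continuous
    Real.continuous_fourierChar (L := innerₗ V) continuous_inner h₁
  refine ae_eq_of_integral_contDiff_smul_eq ((Lp.memLp u).locallyIntegrable one_le_two)
    hcont.locallyIntegrable fun g hg hgc => ?_
  let φ : 𝓢(V, ℂ) := (hgc.comp_left Complex.ofReal_zero).toSchwartzMap
    (Complex.ofRealCLM.contDiff.comp hg)
  calc
    ∫ x, g x • u x = (u : 𝓢'(V, F)) φ := by
      rw [Lp.toTemperedDistribution_apply]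
      exact integral_congr_ae (ae_of_all _ fun x => (Complex.coe_smul (g x) (u x)).symm)
    _ = ∫ x, 𝓕 φ x • f x := by
      rw [hu, ← Lp.fourier_toTemperedDistribution_eq, TemperedDistribution.fourier_apply,
        Lp.toTemperedDistribution_apply]
      exact integral_congr_ae (h₂.coeFn_toLp.mono fun x hx => by simp only [hx])
    _ = ∫ x, φ x • 𝓕 f x := integral_fourier_smul_eq_flip φ.integrable h₁
    _ = ∫ x, g x • 𝓕 f x := by
      exact integral_congr_ae (ae_of_all _ fun x => (Complex.coe_smul (g x) _))

theorem memLp_fourier_two {f : V → F} (h₁ : Integrable f) (h₂ : MemLp f 2) : MemLp (𝓕 f) 2 :=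
  (memLp_congr_ae (fourier_toLp_two_ae_eq h₁ h₂)).mp (Lp.memLp _)

end Plancherel

section ConvPow

section Measurable

variable {G : Type*} [AddCommGroup G] [MeasurableSpace G]

/-- The `(k+1)`-fold convolution power of the indicator function of `B` with respect to `μ`; the
index is shifted because the zeroth convolution power is not a function. -/
def convPow (μ : Measure G) (B : Set G) : ℕ → G → ℝ
  | 0 => B.indicator fun _ => 1
  | k + 1 => fun x => ∫ y in B, convPow μ B k (x - y) ∂μ

variable (μ : Measure G) {B : Set G}

theorem convPow_succ (B : Set G) (k : ℕ) (x : G) :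
    convPow μ B (k + 1) x = ∫ y in B, convPow μ B k (x - y) ∂μ := rfl

theorem convPow_nonneg (B : Set G) (k : ℕ) (x : G) : 0 ≤ convPow μ B k x := by
  induction k generalizing x with
  | zero => exact Set.indicator_nonneg (fun _ _ => zero_le_one) x
  | succ k ih => exact integral_nonneg fun y => ih _

theorem setIntegral_eq_integral_convPow_zero_mul (hB : MeasurableSet B) (F : G → ℝ) :
    ∫ x in B, F x ∂μ = ∫ x, convPow μ B 0 x * F x ∂μ := by
  rw [← integral_indicator hB]
  congr with x
  by_cases h : x ∈ B <;> simp [convPow, h]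

section Neg

variable [MeasurableNeg G] [μ.IsNegInvariant]

theorem setIntegral_comp_neg (hs : ∀ x, -x ∈ B ↔ x ∈ B) (F : G → ℝ) :
    ∫ y in B, F (-y) ∂μ = ∫ y in B, F y ∂μ := by
  have hpre : Neg.neg ⁻¹' B = B := Set.ext hs
  conv_lhs => rw [← hpre]
  exact (Measure.measurePreserving_neg μ).setIntegral_preimage_emb
    (MeasurableEquiv.neg G).measurableEmbedding F B

theorem convPow_neg (hs : ∀ x, -x ∈ B ↔ x ∈ B) (k : ℕ) (x : G) :
    convPow μ B k (-x) = convPow μ B k x := by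
  induction k generalizing x with
  | zero =>
    classical
    simp only [convPow, Set.indicator_apply, hs]
  | succ k ih =>
    rw [convPow_succ, ← setIntegral_comp_neg μ hs, convPow_succ]
    congr with y
    rw [← ih, neg_sub, sub_neg_eq_add, sub_eq_add_neg, add_comm]

theorem convPow_sub_comm (hs : ∀ x, -x ∈ B ↔ x ∈ B) (k : ℕ) (x y : G) :
    convPow μ B k (x - y) = convPow μ B k (y - x) := by
  rw [← convPow_neg μ hs, neg_sub]

end Neg

variable [MeasurableSub₂ G] [IsFiniteMeasure (μ.restrict B)]

theorem bddMeas_convPow (hB : MeasurableSet B) (k : ℕ) : BddMeas (convPow μ B k) := by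
  induction k with
  | zero =>
    refine ⟨measurable_const.indicator hB, 1, fun x => ?_⟩
    exact (norm_indicator_le_norm_self _ _).trans_eq norm_one
  | succ k ih =>
    exact BddMeas.integral_right (F := fun p : G × G => convPow μ B k (p.1 - p.2))
      (ih.comp measurable_sub) _

end Measurable

section Integrable

variable {G : Type*} [AddCommGroup G] [MeasurableSpace G] [MeasurableAdd₂ G] [MeasurableNeg G]
  {μ : Measure G} [SFinite μ] [μ.IsAddLeftInvariant] {B : Set G} [IsFiniteMeasure (μ.restrict B)]

theorem integrable_prod_convPow_sub {p : G → ℝ} (hp : Integrable p μ) :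
    Integrable (fun q : G × G => p (q.1 - q.2)) (μ.prod (μ.restrict B)) := by
  simpa using Integrable.convolution_integrand (ContinuousLinearMap.mul ℝ ℝ)
    (integrable_const (1 : ℝ)) hp (ν := μ.restrict B)

theorem integrable_convPow (hB : MeasurableSet B) (k : ℕ) : Integrable (convPow μ B k) μ := by
  induction k with
  | zero => exact (integrable_indicator_iff hB).mpr (integrable_const _)
  | succ k ih => exact (integrable_prod_convPow_sub ih).integral_prod_left

end Integrable

section Topological

variable {G : Type*} [AddCommGroup G] [TopologicalSpace G] [IsTopologicalAddGroup G]
  [MeasurableSpace G] [BorelSpace G] [SecondCountableTopology G] {μ : Measure G} {B : Set G}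
  [μ.IsAddLeftInvariant] [μ.IsNegInvariant] [IsFiniteMeasure (μ.restrict B)]

theorem continuous_convPow_succ_of_ae (hB : MeasurableSet B) {k : ℕ}
    (h : ∀ᵐ z ∂μ, ContinuousAt (convPow μ B k) z) : Continuous (convPow μ B (k + 1)) := by
  obtain ⟨hm, C, hC⟩ := bddMeas_convPow μ hB k
  refine continuous_iff_continuousAt.mpr fun x₀ => ?_
  refine continuousAt_of_dominated (bound := fun _ => C) ?_ ?_ (integrable_const _) ?_
  · exact Eventually.of_forall fun x => (hm.comp (by fun_prop)).aestronglyMeasurable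
  · exact Eventually.of_forall fun x => ae_of_all _ fun y => hC _
  · refine ae_restrict_of_ae ?_
    filter_upwards [(Measure.measurePreserving_sub_left μ x₀).quasiMeasurePreserving.ae h]
      with y hy
    exact ContinuousAt.comp (f := fun x => x - y) hy (by fun_prop)

theorem continuous_convPow_succ (hB : MeasurableSet B) (hfr : μ (frontier B) = 0) (k : ℕ) :
    Continuous (convPow μ B (k + 1)) := by
  induction k with
  | zero =>
    refine continuous_convPow_succ_of_ae hB ?_
    filter_upwards [measure_eq_zero_iff_ae_notMem.mp hfr] with z hz
    exact continuousOn_const.continuousAt_indicator hz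
  | succ k ih => exact continuous_convPow_succ_of_ae hB (ae_of_all _ fun z => ih.continuousAt)

end Topological

section Vector

variable {V : Type*} [NormedAddCommGroup V] [NormedSpace ℝ V] [MeasurableSpace V]
  [OpensMeasurableSpace V] [MeasurableSub₂ V] {μ : Measure V} {B : Set V}

theorem convPow_pos [μ.IsOpenPosMeasure] [IsFiniteMeasure (μ.restrict B)] (hB : MeasurableSet B)
    (k : ℕ) {z : V} (hz : z ∈ interior B) : 0 < convPow μ B k (((k : ℝ) + 1) • z) := by
  suffices h : ∀ x : V, ((k : ℝ) + 1)⁻¹ • x ∈ interior B → 0 < convPow μ B k x from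
    h _ (by rwa [inv_smul_smul₀ (by positivity)])
  clear hz z
  induction k with
  | zero =>
    intro x hx
    have hxB : x ∈ B := by simpa using interior_subset hx
    simp [convPow, hxB]
  | succ k ih =>
    intro x hx
    set z := (((k + 1 : ℕ) : ℝ) + 1)⁻¹ • x with hz
    have hbdd : BddMeas fun y => convPow μ B k (x - y) :=
      (bddMeas_convPow μ hB k).comp (measurable_const.sub measurable_id)
    refine (integral_pos_iff_support_of_nonneg (fun y => convPow_nonneg μ B k _)
      (hbdd.integrable _)).mpr ?_
    set U : Set V := interior B ∩ (fun y => ((k : ℝ) + 1)⁻¹ • (x - y)) ⁻¹' interior B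
    have hU : IsOpen U := isOpen_interior.inter (isOpen_interior.preimage (by fun_prop))
    have hzU : z ∈ U := by
      refine ⟨hx, ?_⟩
      have hxz : x - z = ((k : ℝ) + 1) • z := by
        have : x = ((k : ℝ) + 1 + 1) • z := by
          rw [hz, Nat.cast_succ, smul_inv_smul₀ (by positivity)]
        rw [this]; module
      rw [Set.mem_preimage, hxz, inv_smul_smul₀ (by positivity)]
      exact hx
    calc 0 < μ U := hU.measure_pos _ ⟨z, hzU⟩
      _ = μ.restrict B U := by
        rw [Measure.restrict_apply hU.measurableSet,
          Set.inter_eq_left.mpr fun y hy => interior_subset hy.1]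
      _ ≤ _ := measure_mono fun y hy => (ih _ hy.2).ne'

end Vector

section Fourier

variable {V : Type*} [NormedAddCommGroup V] [InnerProductSpace ℝ V] [FiniteDimensional ℝ V]
  [MeasurableSpace V] [BorelSpace V] {B : Set V}

theorem integrable_indicator_one (hc : IsCompact B) :
    Integrable (B.indicator fun _ => (1 : ℂ)) :=
  (integrable_indicator_iff hc.measurableSet).mpr (integrableOn_const hc.measure_lt_top.ne)

theorem fourier_convPow (hc : IsCompact B) (k : ℕ) :
    𝓕 (fun x => (convPow volume B k x : ℂ)) =
      fun ξ => 𝓕 (B.indicator fun _ => (1 : ℂ)) ξ ^ (k + 1) := by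
  have hB := hc.measurableSet
  have : IsFiniteMeasure (volume.restrict B) := ⟨by simpa using hc.measure_lt_top⟩
  induction k with
  | zero =>
    have h0 : (fun x => (convPow volume B 0 x : ℂ)) = B.indicator fun _ => 1 := by
      ext x
      by_cases h : x ∈ B <;> simp [convPow, h]
    simp only [h0, zero_add, pow_one]
  | succ k ih =>
    have hconv : (fun x => (convPow volume B (k + 1) x : ℂ)) =
        (B.indicator fun _ => (1 : ℂ)) ⋆[ContinuousLinearMap.mul ℂ ℂ]
          fun x => (convPow volume B k x : ℂ) := by
      ext x
      rw [convolution_def, convPow_succ, ← integral_indicator hB, ← integral_complex_ofReal]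
      congr with y
      by_cases h : y ∈ B <;> simp [h]
    ext ξ
    rw [hconv, pow_succ' _ (k + 1), ← congrFun ih ξ]
    exact Real.fourier_mul_convolution_eq (integrable_indicator_one hc)
      (integrable_convPow hB k).ofReal ξ

theorem integrable_fourier_indicator_pow (hc : IsCompact B) (k : ℕ) :
    Integrable fun ξ => 𝓕 (B.indicator fun _ => (1 : ℂ)) ξ ^ (k + 2) := by
  have h₂ : MemLp (B.indicator fun _ => (1 : ℂ)) 2 :=
    memLp_indicator_const 2 hc.measurableSet 1 (Or.inr hc.measure_lt_top.ne)
  have hF := memLp_fourier_two (integrable_indicator_one hc) h₂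
  set M := ∫ x, ‖B.indicator (fun _ => (1 : ℂ)) x‖
  have hbound (ξ : V) : ‖𝓕 (B.indicator fun _ => (1 : ℂ)) ξ‖ ≤ M :=
    VectorFourier.norm_fourierIntegral_le_integral_norm Real.fourierChar volume (innerₗ V) _ ξ
  simp only [pow_add, sq]
  refine (hF.integrable_mul hF).bdd_mul (c := M ^ k) (hF.aestronglyMeasurable.pow k)
    (ae_of_all _ fun ξ => ?_)
  rw [norm_pow]
  gcongr
  exact hbound ξ

theorem fourierInv_fourier_indicator_pow (hc : IsCompact B) (hfr : volume (frontier B) = 0)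
    (k : ℕ) :
    𝓕⁻ (fun ξ => 𝓕 (B.indicator fun _ => (1 : ℂ)) ξ ^ (k + 2)) =
      fun x => (convPow volume B (k + 1) x : ℂ) := by
  have : IsFiniteMeasure (volume.restrict B) := ⟨by simpa using hc.measure_lt_top⟩
  have hF := fourier_convPow hc (k + 1)
  rw [← hF]
  refine Continuous.fourierInv_fourier_eq
    (Complex.continuous_ofReal.comp (continuous_convPow_succ hc.measurableSet hfr k))
    (integrable_convPow hc.measurableSet (k + 1)).ofReal ?_
  rw [hF]
  exact integrable_fourier_indicator_pow hc k

end Fourier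

end ConvPow

section Sums

theorem integral_pi_succ {α : Type*} [MeasurableSpace α] (ν : Measure α) [IsFiniteMeasure ν]
    {n : ℕ} (i : Fin (n + 1)) {Φ : (Fin (n + 1) → α) → ℝ} (hΦ : BddMeas Φ) :
    ∫ x, Φ x ∂Measure.pi (fun _ => ν) =
      ∫ x, ∫ y, Φ (i.insertNth x y) ∂Measure.pi (fun _ => ν) ∂ν := by
  have hmp := (measurePreserving_piFinSuccAbove (fun _ : Fin (n + 1) => ν) i).symm
  rw [← hmp.integral_comp' Φ]
  exact integral_prod _ ((hΦ.comp (MeasurableEquiv.measurable _)).integrable _)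

theorem BddMeas.comp_sum {G : Type*} [AddCommMonoid G] [MeasurableSpace G] [MeasurableAdd₂ G]
    {g : G → ℝ} (hg : BddMeas g) (n : ℕ) : BddMeas fun x : Fin n → G => g (∑ i, x i) :=
  hg.comp (Finset.measurable_sum _ fun i _ => measurable_pi_apply i)

theorem sum_insertNth {G : Type*} [AddCommMonoid G] {n : ℕ} (i : Fin (n + 1)) (x : G)
    (y : Fin n → G) : ∑ j, i.insertNth (α := fun _ => G) x y j = x + ∑ j, y j := by
  rw [Fin.sum_univ_succAbove _ i, Fin.insertNth_apply_same]
  simp only [Fin.insertNth_apply_succAbove]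

variable {G : Type*} [AddCommGroup G] [MeasurableSpace G] [MeasurableAdd₂ G] [MeasurableNeg G]
  {μ : Measure G} [SFinite μ] [μ.IsAddLeftInvariant] {B : Set G} [IsFiniteMeasure (μ.restrict B)]

theorem integral_comp_sum (hB : MeasurableSet B) (k : ℕ) {g : G → ℝ} (hg : BddMeas g) :
    ∫ x, g (∑ i, x i) ∂Measure.pi (fun _ : Fin (k + 1) => μ.restrict B) =
      ∫ z, convPow μ B k z * g z ∂μ := by
  induction k generalizing g with
  | zero =>
    rw [integral_pi_succ _ 0 (hg.comp_sum _), ← setIntegral_eq_integral_convPow_zero_mul _ hB]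
    simp [measureReal_def]
  | succ k ih =>
    have hint : Integrable (fun q : G × G => convPow μ B k (q.1 - q.2) * g q.1)
        (μ.prod (μ.restrict B)) := by
      obtain ⟨hgm, C, hC⟩ := hg
      exact (integrable_prod_convPow_sub (integrable_convPow hB k)).mul_bdd (c := C)
        (hgm.comp measurable_fst).aestronglyMeasurable (ae_of_all _ fun q => hC _)
    calc
      _ = ∫ x in B, ∫ y, g (x + ∑ i, y i) ∂Measure.pi (fun _ : Fin (k + 1) => μ.restrict B) ∂μ := by
        simp only [integral_pi_succ _ 0 (hg.comp_sum _), sum_insertNth]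
      _ = ∫ x in B, ∫ z, convPow μ B k z * g (x + z) ∂μ ∂μ := by
        congr with x
        exact ih (hg.comp (measurable_const_add x))
      _ = ∫ x in B, ∫ z, convPow μ B k (z - x) * g z ∂μ ∂μ := by
        congr with x
        rw [← integral_add_left_eq_self (fun z => convPow μ B k (z - x) * g z) x]
        simp only [add_sub_cancel_left]
      _ = ∫ z, ∫ x in B, convPow μ B k (z - x) * g z ∂μ ∂μ :=
        (integral_integral_swap hint).symm
      _ = ∫ z, convPow μ B (k + 1) z * g z ∂μ := by
        simp only [integral_mul_const, convPow_succ]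

theorem integral_comp_add_sum (hB : MeasurableSet B) (k : ℕ) {g : G → ℝ} (hg : BddMeas g) (x : G) :
    ∫ y, g (x + ∑ i, y i) ∂Measure.pi (fun _ : Fin (k + 1) => μ.restrict B) =
      ∫ z, convPow μ B k (z - x) * g z ∂μ := by
  rw [integral_comp_sum hB k (hg.comp (measurable_const_add x)),
    ← integral_add_left_eq_self (fun z => convPow μ B k (z - x) * g z) x]
  simp only [add_sub_cancel_left]

theorem integral_mul_comp_sum (hB : MeasurableSet B) (k : ℕ) (i : Fin (k + 2)) {f g : G → ℝ}
    (hf : BddMeas f) (hg : BddMeas g) :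
    ∫ x, f (x i) * g (∑ j, x j) ∂Measure.pi (fun _ => μ.restrict B) =
      ∫ x in B, f x * ∫ z, convPow μ B k (z - x) * g z ∂μ ∂μ := by
  rw [integral_pi_succ _ i ((hf.comp (measurable_pi_apply i)).mul (hg.comp_sum _))]
  simp only [Fin.insertNth_apply_same, sum_insertNth, integral_const_mul,
    integral_comp_add_sum hB k hg]

theorem integral_mul_mul_comp_sum (hB : MeasurableSet B) (k : ℕ) (i : Fin (k + 3))
    (j : Fin (k + 2)) {f f' g : G → ℝ} (hf : BddMeas f) (hf' : BddMeas f') (hg : BddMeas g) :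
    ∫ x, f (x i) * f' (x (i.succAbove j)) * g (∑ j, x j) ∂Measure.pi (fun _ => μ.restrict B) =
      ∫ x in B, ∫ y in B, f x * f' y * ∫ z, convPow μ B k (z - (x + y)) * g z ∂μ ∂μ ∂μ := by
  have hcoord {φ : G → ℝ} (hφ : BddMeas φ) (l : Fin (k + 3)) :
      BddMeas fun x : Fin (k + 3) → G => φ (x l) := hφ.comp (measurable_pi_apply l)
  rw [integral_pi_succ _ i (((hcoord hf i).mul (hcoord hf' (i.succAbove j))).mul (hg.comp_sum _))]
  congr with x
  have hgx : BddMeas fun z => g (x + z) := hg.comp (measurable_const_add x)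
  simp only [Fin.insertNth_apply_same, Fin.insertNth_apply_succAbove, sum_insertNth, mul_assoc,
    integral_const_mul]
  rw [integral_mul_comp_sum hB k j hf' hgx]
  congr with y
  rw [← integral_add_left_eq_self (fun z => convPow μ B k (z - (x + y)) * g z) x]
  simp only [add_sub_add_left_eq_sub]

end Sums

section Forms

variable {G : Type*} [AddCommGroup G] [MeasurableSpace G]

/-- The quadratic form `∫_B f² p_k` of multiplication by `p_k := convPow μ B k`. -/
def weightedSq (μ : Measure G) (B : Set G) (k : ℕ) (f : G → ℝ) : ℝ :=
  ∫ x in B, f x ^ 2 * convPow μ B k x ∂μ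

/-- The quadratic form `∫_B ∫_B f(x) f(y) p_k(x - y)` of convolution with `p_k := convPow μ B k`. -/
def convForm (μ : Measure G) (B : Set G) (k : ℕ) (f : G → ℝ) : ℝ :=
  ∫ x in B, ∫ y in B, f x * f y * convPow μ B k (x - y) ∂μ ∂μ

/-- The failure of `f` to be additive on the sum of the points `x i`. -/
def additiveDefect {n : ℕ} (f : G → ℝ) (x : Fin n → G) : ℝ := ∑ i, f (x i) - f (∑ i, x i)

theorem BddMeas.additiveDefect [MeasurableAdd₂ G] {f : G → ℝ} (hf : BddMeas f) (n : ℕ) :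
    BddMeas fun x : Fin n → G => additiveDefect f x :=
  (BddMeas.sum _ fun i => hf.comp (measurable_pi_apply i)).sub (hf.comp_sum n)

variable {μ : Measure G} {B : Set G}

theorem integral_sq_left_mul_convPow_sub (k : ℕ) (f : G → ℝ) :
    ∫ x in B, ∫ y in B, f x ^ 2 * convPow μ B k (x - y) ∂μ ∂μ = weightedSq μ B (k + 1) f := by
  simp only [integral_const_mul, ← convPow_succ, weightedSq]

section Neg

variable [MeasurableNeg G] [μ.IsNegInvariant]

theorem integral_convPow_sub_mul_indicator (hB : MeasurableSet B) (hs : ∀ x, -x ∈ B ↔ x ∈ B)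
    (k : ℕ) (F : G → ℝ) (x : G) :
    ∫ z, convPow μ B k (z - x) * (convPow μ B 0 z * F z) ∂μ =
      ∫ y in B, convPow μ B k (x - y) * F y ∂μ := by
  rw [setIntegral_eq_integral_convPow_zero_mul _ hB]
  congr with z
  rw [convPow_sub_comm μ hs, mul_left_comm]

theorem integral_convPow_sub_mul_convPow_zero (hB : MeasurableSet B) (hs : ∀ x, -x ∈ B ↔ x ∈ B)
    (k : ℕ) (x : G) :
    ∫ z, convPow μ B k (z - x) * convPow μ B 0 z ∂μ = convPow μ B (k + 1) x := by
  simpa [convPow_succ] using integral_convPow_sub_mul_indicator hB hs k (fun _ => 1) x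

end Neg

section Markov

variable [MeasurableAdd₂ G] [MeasurableNeg G] [IsFiniteMeasure (μ.restrict B)]

theorem BddMeas.integrable_mul_convPow_sub (hB : MeasurableSet B) (k : ℕ) {F : G × G → ℝ}
    (hF : BddMeas F) : Integrable (fun q => F q * convPow μ B k (q.1 - q.2))
      ((μ.restrict B).prod (μ.restrict B)) :=
  (hF.mul ((bddMeas_convPow μ hB k).comp measurable_sub)).integrable _

theorem integral_sub_sq_mul_convPow_sub [μ.IsNegInvariant] (hB : MeasurableSet B)
    (hs : ∀ x, -x ∈ B ↔ x ∈ B) (k : ℕ) {f : G → ℝ} (hf : BddMeas f) :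
    ∫ x in B, ∫ y in B, (f x - f y) ^ 2 * convPow μ B k (x - y) ∂μ ∂μ =
      2 * (weightedSq μ B (k + 1) f - convForm μ B k f) := by
  let p (q : G × G) : ℝ := convPow μ B k (q.1 - q.2)
  let ν := (μ.restrict B).prod (μ.restrict B)
  have hx : BddMeas fun q : G × G => f q.1 := hf.comp measurable_fst
  have hy : BddMeas fun q : G × G => f q.2 := hf.comp measurable_snd
  have ixx : Integrable (fun q => f q.1 ^ 2 * p q) ν := (hx.pow 2).integrable_mul_convPow_sub hB k
  have iyy : Integrable (fun q => f q.2 ^ 2 * p q) ν := (hy.pow 2).integrable_mul_convPow_sub hB k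
  have ixy : Integrable (fun q => f q.1 * f q.2 * p q) ν :=
    (hx.mul hy).integrable_mul_convPow_sub hB k
  have hright : ∫ x in B, ∫ y in B, f y ^ 2 * convPow μ B k (x - y) ∂μ ∂μ =
      weightedSq μ B (k + 1) f := by
    rw [integral_integral_swap iyy, ← integral_sq_left_mul_convPow_sub]
    simp only [convPow_sub_comm μ hs]
  calc
    _ = ∫ q, (f q.1 - f q.2) ^ 2 * p q ∂ν :=
      (integral_prod _ (((hx.sub hy).pow 2).integrable_mul_convPow_sub hB k)).symm
    _ = ∫ q, (f q.1 ^ 2 * p q + f q.2 ^ 2 * p q - 2 * (f q.1 * f q.2 * p q)) ∂ν := by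
      congr with q
      ring
    _ = ∫ q, f q.1 ^ 2 * p q ∂ν + ∫ q, f q.2 ^ 2 * p q ∂ν - 2 * ∫ q, f q.1 * f q.2 * p q ∂ν := by
      have ixx_yy : Integrable (fun q => f q.1 ^ 2 * p q + f q.2 ^ 2 * p q) ν := ixx.add iyy
      rw [integral_sub ixx_yy (ixy.const_mul 2), integral_add ixx iyy, integral_const_mul]
    _ = 2 * (weightedSq μ B (k + 1) f - convForm μ B k f) := by
      rw [integral_prod _ ixx, integral_prod _ iyy, integral_prod _ ixy,
        integral_sq_left_mul_convPow_sub, hright, convForm]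
      ring

end Markov

section Defect

variable [MeasurableAdd₂ G] [MeasurableNeg G] [IsFiniteMeasure (μ.restrict B)]
  [SFinite μ] [μ.IsAddLeftInvariant] (hB : MeasurableSet B) (k : ℕ) {f : G → ℝ} (hf : BddMeas f)
include hB hf

theorem integral_sq_sum :
    ∫ x, f (∑ i, x i) ^ 2 * convPow μ B 0 (∑ i, x i)
      ∂Measure.pi (fun _ : Fin (k + 1) => μ.restrict B) = weightedSq μ B k f := by
  rw [integral_comp_sum hB k ((hf.pow 2).mul (bddMeas_convPow μ hB 0)), weightedSq,
    setIntegral_eq_integral_convPow_zero_mul _ hB]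
  congr with z
  ring

variable [μ.IsNegInvariant] (hs : ∀ x, -x ∈ B ↔ x ∈ B)
include hs

theorem integral_coord_mul_sum (i : Fin (k + 2)) :
    ∫ x, f (x i) * f (∑ i, x i) * convPow μ B 0 (∑ i, x i)
      ∂Measure.pi (fun _ => μ.restrict B) = convForm μ B k f := by
  simp only [mul_assoc, mul_comm (f (∑ _, _))]
  rw [integral_mul_comp_sum hB k i (g := fun z => convPow μ B 0 z * f z) hf
    ((bddMeas_convPow μ hB 0).mul hf), convForm]
  simp only [integral_convPow_sub_mul_indicator hB hs, mul_assoc, integral_const_mul,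
    mul_comm (f _) (convPow _ _ _ _)]

theorem integral_sq_coord (i : Fin (k + 2)) :
    ∫ x, f (x i) ^ 2 * convPow μ B 0 (∑ i, x i) ∂Measure.pi (fun _ => μ.restrict B) =
      weightedSq μ B (k + 1) f := by
  rw [integral_mul_comp_sum hB k i (f := fun z => f z ^ 2) (hf.pow 2) (bddMeas_convPow μ hB 0),
    weightedSq]
  simp only [integral_convPow_sub_mul_convPow_zero hB hs]

theorem integral_coord_mul_coord (hodd : ∀ x, f (-x) = -f x) (i : Fin (k + 3)) (j : Fin (k + 2)) :
    ∫ x, f (x i) * f (x (i.succAbove j)) * convPow μ B 0 (∑ i, x i)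
      ∂Measure.pi (fun _ => μ.restrict B) = -convForm μ B (k + 1) f := by
  rw [integral_mul_mul_comp_sum hB k i j hf hf (bddMeas_convPow μ hB 0), convForm, ← integral_neg]
  congr with x
  rw [← setIntegral_comp_neg μ hs, ← integral_neg]
  congr with y
  rw [integral_convPow_sub_mul_convPow_zero hB hs, hodd, ← sub_eq_add_neg]
  ring

theorem integral_additiveDefect_mul_sum :
    ∫ x, additiveDefect f x * f (∑ i, x i) * convPow μ B 0 (∑ i, x i)
      ∂Measure.pi (fun _ : Fin (k + 2) => μ.restrict B) =
      (k + 2) * convForm μ B k f - weightedSq μ B (k + 1) f := by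
  have hind := bddMeas_convPow μ hB 0
  have hcross (i : Fin (k + 2)) : BddMeas fun x : Fin (k + 2) → G =>
      f (x i) * f (∑ i, x i) * convPow μ B 0 (∑ i, x i) :=
    ((hf.comp (measurable_pi_apply i)).mul (hf.comp_sum _)).mul (hind.comp_sum _)
  have hsum : BddMeas fun x : Fin (k + 2) → G =>
      f (∑ i, x i) ^ 2 * convPow μ B 0 (∑ i, x i) :=
    ((hf.comp_sum _).pow 2).mul (hind.comp_sum _)
  simp only [additiveDefect, sub_mul, Finset.sum_mul, ← sq]
  rw [integral_sub ((BddMeas.sum _ hcross).integrable _) (hsum.integrable _),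
    integral_finsetSum _ fun i _ => (hcross i).integrable _, integral_sq_sum hB (k + 1) hf]
  simp only [integral_coord_mul_sum hB k hf hs, Finset.sum_const, Finset.card_univ,
    Fintype.card_fin, nsmul_eq_mul]
  push_cast
  rfl

variable (hodd : ∀ x, f (-x) = -f x)
include hodd

theorem integral_coord_mul_sum_coord (i : Fin (k + 3)) :
    ∫ x, f (x i) * (∑ j, f (x j)) * convPow μ B 0 (∑ i, x i)
      ∂Measure.pi (fun _ => μ.restrict B) =
      weightedSq μ B (k + 2) f - (k + 2) * convForm μ B (k + 1) f := by
  have hind := bddMeas_convPow μ hB 0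
  have hcoord (l : Fin (k + 3)) : BddMeas fun x : Fin (k + 3) → G => f (x l) :=
    hf.comp (measurable_pi_apply l)
  have hsq := ((hcoord i).pow 2).mul (hind.comp_sum (k + 3))
  have hcross (j : Fin (k + 2)) :=
    ((hcoord i).mul (hcoord (i.succAbove j))).mul (hind.comp_sum (k + 3))
  simp only [fun x : Fin (k + 3) → G => Fin.sum_univ_succAbove (fun j => f (x j)) i, mul_add,
    add_mul, Finset.mul_sum, Finset.sum_mul, ← sq]
  rw [integral_add (hsq.integrable _) ((BddMeas.sum _ hcross).integrable _),
    integral_finsetSum _ fun j _ => (hcross j).integrable _, integral_sq_coord hB (k + 1) hf hs]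
  simp only [integral_coord_mul_coord hB k hf hs hodd, Finset.sum_const, Finset.card_univ,
    Fintype.card_fin, nsmul_eq_mul]
  push_cast
  ring

theorem integral_coord_mul_additiveDefect (i : Fin (k + 3)) :
    ∫ x, f (x i) * additiveDefect f x * convPow μ B 0 (∑ i, x i)
      ∂Measure.pi (fun _ => μ.restrict B) =
      weightedSq μ B (k + 2) f - (k + 3) * convForm μ B (k + 1) f := by
  have hind := bddMeas_convPow μ hB 0
  have hcoord (l : Fin (k + 3)) : BddMeas fun x : Fin (k + 3) → G => f (x l) :=
    hf.comp (measurable_pi_apply l)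
  have hcoords := ((hcoord i).mul (BddMeas.sum Finset.univ hcoord)).mul (hind.comp_sum (k + 3))
  have hsum := ((hcoord i).mul (hf.comp_sum _)).mul (hind.comp_sum (k + 3))
  simp only [additiveDefect, mul_sub, sub_mul]
  rw [integral_sub (hcoords.integrable _) (hsum.integrable _),
    integral_coord_mul_sum_coord hB k hf hs hodd, integral_coord_mul_sum hB (k + 1) hf hs]
  ring

/-- With `x₀ = -∑ xᵢ` the defect is the sum of `f` over `k + 4` points of zero sum, each of which
contributes the same cross term. -/
theorem integral_additiveDefect_sq :
    ∫ x, additiveDefect f x ^ 2 * convPow μ B 0 (∑ i, x i)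
      ∂Measure.pi (fun _ : Fin (k + 3) => μ.restrict B) =
      (k + 4) * (weightedSq μ B (k + 2) f - (k + 3) * convForm μ B (k + 1) f) := by
  have hind := bddMeas_convPow μ hB 0
  have hdef := hf.additiveDefect (k + 3)
  have hcoord (i : Fin (k + 3)) :=
    ((hf.comp (measurable_pi_apply i)).mul hdef).mul (hind.comp_sum _)
  have hsum := (hdef.mul (hf.comp_sum _)).mul (hind.comp_sum _)
  have hexpand (x : Fin (k + 3) → G) :
      additiveDefect f x ^ 2 * convPow μ B 0 (∑ i, x i) =
        ∑ i, f (x i) * additiveDefect f x * convPow μ B 0 (∑ i, x i) -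
          additiveDefect f x * f (∑ i, x i) * convPow μ B 0 (∑ i, x i) := by
    rw [← Finset.sum_mul, ← Finset.sum_mul, ← sub_mul, mul_comm _ (f _), ← sub_mul, sq]
    rfl
  simp only [hexpand]
  rw [integral_sub ((BddMeas.sum _ hcoord).integrable _) (hsum.integrable _),
    integral_finsetSum _ fun i _ => (hcoord i).integrable _,
    integral_additiveDefect_mul_sum hB (k + 1) hf hs]
  simp only [integral_coord_mul_additiveDefect hB k hf hs hodd, Finset.sum_const, Finset.card_univ,
    Fintype.card_fin, nsmul_eq_mul]
  push_cast
  ring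

end Defect

end Forms

/-! ### Compact operators and parity -/

section Gap

variable {E : Type*} [NormedAddCommGroup E] [InnerProductSpace ℝ E]

theorem norm_sq_le_opNorm_mul_inner_of_isPositive {M : E →L[ℝ] E} (hM : M.IsPositive) (x : E) :
    ‖M x‖ ^ 2 ≤ ‖M‖ * inner ℝ x (M x) := by
  have hCS : inner ℝ x (M (M x)) ^ 2 ≤ inner ℝ x (M x) * inner ℝ (M x) (M (M x)) :=
    LinearMap.BilinForm.apply_sq_le_of_symm ((innerₗ E).compl₂ (M : E →ₗ[ℝ] E))
      hM.inner_nonneg_right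
      ⟨fun x y => (hM.isSymmetric x y).symm.trans (real_inner_comm _ _)⟩ x (M x)
  rw [← hM.inner_left_eq_inner_right, real_inner_self_eq_norm_sq] at hCS
  rcases (norm_nonneg (M x)).eq_or_lt with h0 | h0
  · rw [← h0, zero_pow two_ne_zero]
    exact mul_nonneg (norm_nonneg M) (hM.inner_nonneg_right x)
  refine le_of_mul_le_mul_right ?_ (pow_pos h0 2)
  calc ‖M x‖ ^ 2 * ‖M x‖ ^ 2 = (‖M x‖ ^ 2) ^ 2 := (sq _).symm
    _ ≤ inner ℝ x (M x) * inner ℝ (M x) (M (M x)) := hCS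
    _ ≤ inner ℝ x (M x) * (‖M x‖ * (‖M‖ * ‖M x‖)) := by
      gcongr
      · exact hM.inner_nonneg_right x
      · exact (real_inner_le_norm _ _).trans (by gcongr; exact M.le_opNorm _)
    _ = ‖M‖ * inner ℝ x (M x) * ‖M x‖ ^ 2 := by ring

theorem apply_eq_zero_of_isPositive_of_inner_eq_zero {M : E →L[ℝ] E} (hM : M.IsPositive) {x : E}
    (hx : inner ℝ x (M x) = 0) : M x = 0 := by
  simpa [hx, sq_nonpos_iff] using norm_sq_le_opNorm_mul_inner_of_isPositive hM x

variable {C : E →L[ℝ] E} {H : Submodule ℝ E} [H.HasOrthogonalProjection]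

theorem exists_mul_norm_le_norm_sub_of_isCompactOperator (hC : IsCompactOperator C)
    (hs : C.IsSymmetric) (hH : ∀ x, x ∈ H ↔ C x = x) :
    ∃ b : ℝ, 0 < b ∧ ∀ y ∈ Hᗮ, b * ‖y‖ ≤ ‖y - C y‖ := by
  have hperp : ∀ y ∈ Hᗮ, C y ∈ Hᗮ := fun y hy u hu => by
    have := hs u y
    simp only [ContinuousLinearMap.coe_coe, (hH u).mp hu] at this
    rw [← this, hy u hu]
  have hproj {y : E} (hy : y ∈ Hᗮ) : H.starProjection y = 0 :=
    (Submodule.starProjection_apply_eq_zero_iff H).mpr hy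
  let S : E →L[ℝ] E := C ∘L (1 - H.starProjection)
  have hne : ¬ Module.End.HasEigenvalue (S : Module.End ℝ E) 1 := by
    intro h
    obtain ⟨x, hx⟩ := h.exists_hasEigenvector
    have hSx : C (x - H.starProjection x) = x := by simpa [S] using hx.apply_eq_smul
    have hxperp : x ∈ Hᗮ := hSx ▸ hperp _ (Submodule.sub_starProjection_mem_orthogonal x)
    rw [hproj hxperp, sub_zero] at hSx
    exact hx.2 (by simpa using Submodule.inner_right_of_mem_orthogonal ((hH x).mpr hSx) hxperp)
  obtain ⟨κ, hκ⟩ := (hC.comp_clm _ : IsCompactOperator S).antilipschitz_of_not_hasEigenvalue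
    one_ne_zero hne
  obtain ⟨b, hb, hbound⟩ := antilipschitzWith_iff_exists_mul_le_norm.mp ⟨κ, hκ⟩
  refine ⟨b, hb, fun y hy => (hbound y).trans_eq ?_⟩
  rw [norm_sub_rev]
  simp [S, hproj hy]

theorem exists_gap_of_isCompactOperator (hC : IsCompactOperator C) (hpos : (1 - C).IsPositive)
    (hH : ∀ x, x ∈ H ↔ C x = x) :
    ∃ c : ℝ, 0 < c ∧ ∀ x, c * ‖x - H.starProjection x‖ ^ 2 ≤ inner ℝ x (x - C x) := by
  have hs : C.IsSymmetric := by
    simpa using (ContinuousLinearMap.isPositive_one (𝕜 := ℝ) (E := E)).isSymmetric.sub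
      hpos.isSymmetric
  obtain ⟨b, hb, hbound⟩ := exists_mul_norm_le_norm_sub_of_isCompactOperator hC hs hH
  have hm : 0 < ‖1 - C‖ + 1 := by positivity
  refine ⟨b ^ 2 / (‖1 - C‖ + 1), by positivity, fun x => ?_⟩
  set y := x - H.starProjection x with hy
  have hyH : y ∈ Hᗮ := Submodule.sub_starProjection_mem_orthogonal x
  have hkill : (1 - C) (H.starProjection x) = 0 := by
    simp [(hH _).mp (Submodule.starProjection_apply_mem H x)]
  have hx : x = y + H.starProjection x := by rw [hy, sub_add_cancel]
  have hform : inner ℝ x ((1 - C) x) = inner ℝ y ((1 - C) y) := by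
    rw [hx, map_add, hkill, add_zero, inner_add_left,
      ← hpos.inner_left_eq_inner_right (H.starProjection x), hkill, inner_zero_left, add_zero]
  rw [div_mul_eq_mul_div, div_le_iff₀ hm]
  calc b ^ 2 * ‖y‖ ^ 2 = (b * ‖y‖) ^ 2 := (mul_pow _ _ _).symm
    _ ≤ ‖(1 - C) y‖ ^ 2 := by
      gcongr
      exact hbound y hyH
    _ ≤ ‖1 - C‖ * inner ℝ y ((1 - C) y) := norm_sq_le_opNorm_mul_inner_of_isPositive hpos y
    _ ≤ (‖1 - C‖ + 1) * inner ℝ y ((1 - C) y) := by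
      gcongr
      · exact hpos.inner_nonneg_right y
      · linarith
    _ = inner ℝ x (x - C x) * (‖1 - C‖ + 1) := by
      rw [← hform, mul_comm]
      rfl

end Gap

section Parity

variable {E : Type*} [NormedAddCommGroup E] [InnerProductSpace ℝ E] (R : E →ₗᵢ[ℝ] E)

/-- The part of `x` fixed by the involution `R`. -/
def evenPart (x : E) : E := (1 / 2 : ℝ) • (x + R x)

/-- The part of `x` negated by the involution `R`. -/
def oddPart (x : E) : E := (1 / 2 : ℝ) • (x - R x)

theorem evenPart_add_oddPart (x : E) : evenPart R x + oddPart R x = x := by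
  simp only [evenPart, oddPart]
  module

/-- For an operator `T` commuting with the involution `R`, the operator acting as `T` on the vectors
fixed by `R` and as `m • T` on the vectors negated by `R`. -/
def parityOp (m : ℝ) (T : E →L[ℝ] E) : E →L[ℝ] E :=
  ((1 + m) / 2) • T + ((1 - m) / 2) • T ∘L R.toContinuousLinearMap

variable {R} {m : ℝ} {T : E →L[ℝ] E}

theorem parityOp_apply (x : E) :
    parityOp R m T x = ((1 + m) / 2) • T x + ((1 - m) / 2) • T (R x) := rfl

theorem isCompactOperator_parityOp (hT : IsCompactOperator T) :
    IsCompactOperator (parityOp R m T) :=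
  (hT.smul _).add ((hT.comp_clm _).smul _)

theorem parityOp_of_even {x : E} (hx : R x = x) : parityOp R m T x = T x := by
  rw [parityOp_apply, hx]
  module

theorem parityOp_of_odd {x : E} (hx : R x = -x) : parityOp R m T x = m • T x := by
  rw [parityOp_apply, hx, map_neg]
  module

theorem oddPart_of_odd {x : E} (hx : R x = -x) : oddPart R x = x := by
  rw [oddPart, hx]
  module

theorem inner_eq_zero_of_even_of_odd {x y : E} (hx : R x = x) (hy : R y = -y) :
    inner ℝ x y = 0 := by
  have h := R.inner_map_map x y
  rw [hx, hy, inner_neg_right] at h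
  linarith

variable (hR : ∀ x, R (R x) = x)
include hR

theorem map_evenPart (x : E) : R (evenPart R x) = evenPart R x := by
  rw [evenPart, map_smul, map_add, hR, add_comm]

theorem map_oddPart (x : E) : R (oddPart R x) = -oddPart R x := by
  rw [oddPart, map_smul, map_sub, hR, ← smul_neg, neg_sub]

theorem parityOp_eq_add (x : E) :
    parityOp R m T x = T (evenPart R x) + m • T (oddPart R x) := by
  conv_lhs => rw [← evenPart_add_oddPart R x]
  rw [map_add, parityOp_of_even (map_evenPart hR x), parityOp_of_odd (map_oddPart hR x)]

variable (hTR : ∀ x, T (R x) = R (T x))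
include hTR

theorem isSymmetric_parityOp (hs : T.IsSymmetric) : (parityOp R m T).IsSymmetric := by
  have hR' (x y : E) : inner ℝ (R x) y = inner ℝ x (R y) := by
    rw [← R.inner_map_map, hR]
  intro x y
  have h₁ : inner ℝ (T x) y = inner ℝ x (T y) := hs x y
  have h₂ : inner ℝ (T (R x)) y = inner ℝ x (T (R y)) := by
    rw [hTR, hTR, hR', ← hTR]
    exact hs x (R y)
  simp only [ContinuousLinearMap.coe_coe, parityOp_apply, inner_add_left, inner_add_right,
    real_inner_smul_left, real_inner_smul_right, h₁, h₂]

theorem eq_evenPart_and_eq_oddPart_of_parityOp_eq_self {x : E} (hx : parityOp R m T x = x) :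
    T (evenPart R x) = evenPart R x ∧ m • T (oddPart R x) = oddPart R x := by
  set e := T (evenPart R x) with he
  set o := m • T (oddPart R x) with ho
  have hsum : x = e + o := hx.symm.trans (parityOp_eq_add hR x)
  have hRe : R e = e := by rw [he, ← hTR, map_evenPart hR]
  have hRo : R o = -o := by rw [ho, map_smul, ← hTR, map_oddPart hR, map_neg, smul_neg]
  have hRx : R x = e - o := by rw [hsum, map_add, hRe, hRo, sub_eq_add_neg]
  constructor
  · rw [evenPart, hRx]
    nth_rw 1 [hsum]
    module
  · rw [oddPart, hRx]
    nth_rw 1 [hsum]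
    module

theorem inner_sub_parityOp (x : E) :
    inner ℝ x (x - parityOp R m T x) =
      inner ℝ (evenPart R x) (evenPart R x - T (evenPart R x)) +
        inner ℝ (oddPart R x) (oddPart R x - m • T (oddPart R x)) := by
  have he := map_evenPart hR x
  have ho := map_oddPart hR x
  have hsum := evenPart_add_oddPart R x
  rw [parityOp_eq_add hR]
  generalize evenPart R x = e at *
  generalize oddPart R x = o at *
  have heven : R (e - T e) = e - T e := by rw [map_sub, ← hTR, he]
  have hodd : R (o - m • T o) = -(o - m • T o) := by
    rw [map_sub, map_smul, ← hTR, ho, map_neg, smul_neg, neg_sub, sub_neg_eq_add, neg_add_eq_sub]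
  rw [← hsum, add_sub_add_comm, inner_add_left, inner_add_right, inner_add_right,
    inner_eq_zero_of_even_of_odd he hodd, real_inner_comm (e - T e) o,
    inner_eq_zero_of_even_of_odd heven ho, add_zero, zero_add]

theorem isPositive_one_sub_parityOp (hs : T.IsSymmetric)
    (heven : ∀ x, R x = x → 0 ≤ inner ℝ x (x - T x))
    (hodd : ∀ x, R x = -x → 0 ≤ inner ℝ x (x - m • T x)) : (1 - parityOp R m T).IsPositive := by
  refine ⟨(ContinuousLinearMap.isPositive_one (𝕜 := ℝ) (E := E)).isSymmetric.sub
    (isSymmetric_parityOp hR hTR hs), fun x => ?_⟩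
  have h : 0 ≤ inner ℝ x (x - parityOp R m T x) := by
    rw [inner_sub_parityOp hR hTR]
    exact add_nonneg (heven _ (map_evenPart hR x)) (hodd _ (map_oddPart hR x))
  rwa [real_inner_comm] at h

end Parity

/-! ### Integral operators -/

section KernelOp

variable {X : Type*} [MeasurableSpace X] {μ : Measure X} {E : Type*} [NormedAddCommGroup E]
  [InnerProductSpace ℝ E]

/-- The operator `h ↦ (x ↦ ⟨h, κ(x)⟩)` with square-integrable vector-valued kernel `κ`,
as a bounded bilinear map of `κ` and `h`. -/
def kernelOp (E : Type*) [NormedAddCommGroup E] [InnerProductSpace ℝ E] (μ : Measure X) :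
    Lp E 2 μ →L[ℝ] E →L[ℝ] Lp ℝ 2 μ :=
  LinearMap.mkContinuous₂
    (LinearMap.mk₂ ℝ (fun κ h => (innerSL ℝ h).compLp κ)
      (fun κ κ' h => ((innerSL ℝ h).compLpₗ 2 μ).map_add κ κ')
      (fun c κ h => ((innerSL ℝ h).compLpₗ 2 μ).map_smul c κ)
      (fun κ h h' => by rw [map_add, ContinuousLinearMap.add_compLp])
      (fun c κ h => by rw [map_smul, ContinuousLinearMap.smul_compLp])) 1
    (fun κ h => by
      simpa [mul_comm] using! (innerSL ℝ h).norm_compLp_le κ)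

theorem kernelOp_apply (κ : Lp E 2 μ) (h : E) :
    kernelOp E μ κ h =ᵐ[μ] fun x => inner ℝ h (κ x) :=
  (innerSL ℝ h).coeFn_compLp' κ

theorem kernelOp_indicatorConstLp {s : Set X} (hs : MeasurableSet s) (hμs : μ s ≠ ⊤) (c : E) :
    kernelOp E μ (indicatorConstLp 2 hs hμs c) =
      (innerSL ℝ c).smulRight (indicatorConstLp 2 hs hμs (1 : ℝ)) := by
  ext1 h
  refine Lp.ext ?_
  rw [ContinuousLinearMap.smulRight_apply]
  filter_upwards [kernelOp_apply (indicatorConstLp 2 hs hμs c) h,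
    indicatorConstLp_coeFn (p := 2) (hs := hs) (hμs := hμs) (c := c),
    indicatorConstLp_coeFn (p := 2) (hs := hs) (hμs := hμs) (c := (1 : ℝ)),
    Lp.coeFn_smul (innerSL ℝ c h) (indicatorConstLp 2 hs hμs (1 : ℝ))] with x h₁ h₂ h₃ h₄
  rw [h₁, h₄, Pi.smul_apply, h₂, h₃, innerSL_apply_apply, real_inner_comm]
  by_cases hx : x ∈ s <;> simp [hx]

theorem isCompactOperator_kernelOp (κ : Lp E 2 μ) : IsCompactOperator (kernelOp E μ κ) := by
  induction κ using Lp.induction (p := 2) (μ := μ) (E := E) ENNReal.ofNat_ne_top with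
  | @indicatorConst c s hs hμs =>
    rw [Lp.simpleFunc.coe_indicatorConst, kernelOp_indicatorConstLp]
    exact (isCompactOperator_of_locallyCompactSpace_dom (innerSL ℝ c)).clm_comp
      (ContinuousLinearMap.toSpanSingleton ℝ (indicatorConstLp 2 hs hμs.ne (1 : ℝ)))
  | add _ _ _ hf hg => rw [map_add]; exact hf.add hg
  | isClosed =>
    exact isClosed_setOfPred_isCompactOperator.preimage (kernelOp E μ).continuous

end KernelOp

theorem measurable_of_measurable_dist {X Y : Type*} [MeasurableSpace X] [PseudoMetricSpace Y]
    [SecondCountableTopology Y] [MeasurableSpace Y] [BorelSpace Y] {f : X → Y}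
    (hf : ∀ c, Measurable fun x => dist (f x) c) : Measurable f := by
  refine measurable_of_isOpen fun U hU => ?_
  choose! r hr hball using Metric.isOpen_iff.mp hU
  obtain ⟨t, -, htc, hUt⟩ := TopologicalSpace.isOpen_biUnion_countable U
    (fun y => Metric.ball y (r y)) fun y _ => Metric.isOpen_ball
  have hU' : U = ⋃ y ∈ t, Metric.ball y (r y) := by
    rw [hUt]
    exact (Set.iUnion₂_subset hball).antisymm'
      fun y hy => Set.mem_biUnion hy (Metric.mem_ball_self (hr y hy))
  rw [hU', Set.preimage_iUnion₂]
  exact .biUnion htc fun y _ => hf y measurableSet_Iio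

section IntegralOp

variable {X : Type*} [MeasurableSpace X] {ν : Measure X}

theorem inner_Lp_two_eq_integral (f g : Lp ℝ 2 ν) : inner ℝ f g = ∫ x, f x * g x ∂ν := by
  rw [L2.inner_def]
  congr with x
  exact mul_comm _ _

theorem BddMeas.integrable_mul {f : X → ℝ} (hf : BddMeas f) {h : X → ℝ} (hh : Integrable h ν) :
    Integrable (fun x => f x * h x) ν := by
  obtain ⟨hf, C, hC⟩ := hf
  exact hh.bdd_mul hf.aestronglyMeasurable (ae_of_all _ hC)

variable [IsFiniteMeasure ν] {κ : X × X → ℝ}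

theorem integrable_of_Lp_two (f : Lp ℝ 2 ν) : Integrable f ν :=
  (Lp.memLp f).integrable one_le_two

/-- The slice `κ(x, ·)` of a bounded kernel as an element of `L²`. -/
def kernelSlice (ν : Measure X) [IsFiniteMeasure ν] (hκ : BddMeas κ) (x : X) : Lp ℝ 2 ν :=
  ((hκ.comp measurable_prodMk_left).memLp 2 ν).toLp fun y => κ (x, y)

theorem kernelSlice_ae_eq (hκ : BddMeas κ) (x : X) :
    kernelSlice ν hκ x =ᵐ[ν] fun y => κ (x, y) := MemLp.coeFn_toLp _

theorem inner_kernelSlice (hκ : BddMeas κ) (h : Lp ℝ 2 ν) (x : X) :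
    inner ℝ h (kernelSlice ν hκ x) = ∫ y, κ (x, y) * h y ∂ν := by
  rw [inner_Lp_two_eq_integral]
  refine integral_congr_ae ?_
  filter_upwards [kernelSlice_ae_eq hκ x] with y hy
  rw [hy, mul_comm]

variable [MeasurableSpace.CountablyGenerated X]

theorem aestronglyMeasurable_kernelSlice (hκ : BddMeas κ) :
    AEStronglyMeasurable (kernelSlice ν hκ) ν := by
  let : MeasurableSpace (Lp ℝ 2 ν) := borel _
  have : BorelSpace (Lp ℝ 2 ν) := ⟨rfl⟩
  have : Fact ((2 : ENNReal) ≠ ⊤) := ⟨ENNReal.ofNat_ne_top⟩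
  have : SecondCountableTopology (Lp ℝ 2 ν) := Lp.SecondCountableTopology
  refine (measurable_of_measurable_dist fun c => ?_).aestronglyMeasurable
  have hdist (x : X) : dist (kernelSlice ν hκ x) c =
      √(∫ y, κ (x, y) ^ 2 ∂ν - 2 * ∫ y, κ (x, y) * c y ∂ν + ‖c‖ ^ 2) := by
    have hsq : ‖kernelSlice ν hκ x‖ ^ 2 = ∫ y, κ (x, y) ^ 2 ∂ν := by
      rw [← real_inner_self_eq_norm_sq, inner_kernelSlice]
      refine integral_congr_ae ?_
      filter_upwards [kernelSlice_ae_eq hκ x] with y hy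
      rw [hy, sq]
    rw [dist_eq_norm, ← Real.sqrt_sq (norm_nonneg _), norm_sub_sq_real, hsq, real_inner_comm,
      inner_kernelSlice]
  simp only [hdist]
  have hlin : Measurable fun x => ∫ y, κ (x, y) * c y ∂ν :=
    (hκ.1.stronglyMeasurable.mul
      ((Lp.stronglyMeasurable c).comp_measurable measurable_snd)).integral_prod_right'.measurable
  exact (((((hκ.pow 2).integral_right ν).1.sub (hlin.const_mul 2)).add_const _).sqrt)

theorem memLp_kernelSlice (hκ : BddMeas κ) : MemLp (kernelSlice ν hκ) 2 ν := by
  obtain ⟨hm, C, hC⟩ := hκ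
  refine MemLp.of_bound (aestronglyMeasurable_kernelSlice ⟨hm, C, hC⟩)
    (measureUnivNNReal ν ^ (2 : ENNReal).toReal⁻¹ * max C 0) (ae_of_all _ fun x => ?_)
  refine Lp.norm_le_of_ae_bound (le_max_right C 0) ?_
  filter_upwards [kernelSlice_ae_eq ⟨hm, C, hC⟩ x] with y hy
  rw [hy]
  exact (hC _).trans (le_max_left _ _)

/-- The integral operator on `L²` of a finite measure with bounded kernel `κ`. -/
def integralOp (ν : Measure X) [IsFiniteMeasure ν] (hκ : BddMeas κ) :
    Lp ℝ 2 ν →L[ℝ] Lp ℝ 2 ν :=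
  kernelOp (Lp ℝ 2 ν) ν (memLp_kernelSlice hκ).toLp

theorem integralOp_ae_eq (hκ : BddMeas κ) (h : Lp ℝ 2 ν) :
    integralOp ν hκ h =ᵐ[ν] fun x => ∫ y, κ (x, y) * h y ∂ν := by
  filter_upwards [kernelOp_apply (memLp_kernelSlice hκ).toLp h,
    (memLp_kernelSlice (ν := ν) hκ).coeFn_toLp] with x h₁ h₂
  rw [integralOp, h₁, h₂, inner_kernelSlice]

theorem isCompactOperator_integralOp (hκ : BddMeas κ) : IsCompactOperator (integralOp ν hκ) :=
  isCompactOperator_kernelOp _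

theorem inner_integralOp (hκ : BddMeas κ) (f h : Lp ℝ 2 ν) :
    inner ℝ f (integralOp ν hκ h) = ∫ x, ∫ y, κ (x, y) * (f x * h y) ∂ν ∂ν := by
  rw [inner_Lp_two_eq_integral]
  refine integral_congr_ae ?_
  filter_upwards [integralOp_ae_eq hκ h] with x hx
  rw [hx, ← integral_const_mul]
  congr with y
  ring

theorem isSymmetric_integralOp (hκ : BddMeas κ) (hs : ∀ x y, κ (x, y) = κ (y, x)) :
    (integralOp ν hκ).IsSymmetric := fun f h => by
  have hint : Integrable (fun q : X × X => κ q * (h q.1 * f q.2)) (ν.prod ν) :=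
    hκ.integrable_mul ((integrable_of_Lp_two h).mul_prod (integrable_of_Lp_two f))
  rw [real_inner_comm]
  simp only [ContinuousLinearMap.coe_coe, inner_integralOp]
  rw [integral_integral_swap hint]
  simp only [hs, mul_comm]

theorem integralOp_compMeasurePreserving (hκ : BddMeas κ) (σ : X ≃ᵐ X)
    (hσ : MeasurePreserving σ ν ν) (hκσ : ∀ x y, κ (σ x, σ y) = κ (x, y)) (h : Lp ℝ 2 ν) :
    integralOp ν hκ (Lp.compMeasurePreserving σ hσ h) =
      Lp.compMeasurePreserving σ hσ (integralOp ν hκ h) := by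
  refine Lp.ext ?_
  filter_upwards [integralOp_ae_eq hκ (Lp.compMeasurePreserving σ hσ h),
    Lp.coeFn_compMeasurePreserving (integralOp ν hκ h) hσ,
    hσ.quasiMeasurePreserving.ae (integralOp_ae_eq hκ h)] with x h₁ h₂ h₃
  rw [h₁, h₂, Function.comp_apply, h₃,
    ← hσ.integral_comp' fun y => κ (σ x, y) * h y]
  refine integral_congr_ae ?_
  filter_upwards [Lp.coeFn_compMeasurePreserving h hσ] with y hy
  rw [hy, hκσ, Function.comp_apply]

end IntegralOp

/-! ### Local additivity -/

section Additive

variable {E F : Type*} [AddCommGroup E] [Module ℝ E] [AddCommGroup F] [Module ℝ F]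
  {U : Set E} {f : E → F}

theorem map_half_pow_smul_of_add (hU : StarConvex ℝ 0 U)
    (hadd : ∀ x ∈ U, ∀ y ∈ U, x + y ∈ U → f (x + y) = f x + f y) {x : E} (hx : x ∈ U) (n : ℕ) :
    f ((1 / 2 : ℝ) ^ n • x) = (1 / 2 : ℝ) ^ n • f x := by
  induction n with
  | zero => simp
  | succ n ih =>
    have hmem (m : ℕ) : (1 / 2 : ℝ) ^ m • x ∈ U :=
      hU.smul_mem hx (by positivity) (pow_le_one₀ (by norm_num) (by norm_num))
    have hsplit : (1 / 2 : ℝ) ^ (n + 1) • x + (1 / 2 : ℝ) ^ (n + 1) • x = (1 / 2 : ℝ) ^ n • x := by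
      rw [← add_smul]
      ring_nf
    have h := hadd _ (hmem (n + 1)) _ (hmem (n + 1)) (hsplit ▸ hmem n)
    rw [hsplit, ih] at h
    rw [pow_succ', mul_smul, mul_smul, ← mul_smul, ← pow_succ', h, ← two_smul ℝ, smul_smul]
    norm_num

variable [TopologicalSpace E] [ContinuousSMul ℝ E]

theorem exists_addMonoidHom_eqOn_of_add (hU0 : U ∈ 𝓝 0) (hU : StarConvex ℝ 0 U)
    (hadd : ∀ x ∈ U, ∀ y ∈ U, x + y ∈ U → f (x + y) = f x + f y) :
    ∃ g : E →+ F, Set.EqOn f g U := by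
  have hsmall (x : E) : ∀ᶠ n : ℕ in atTop, (1 / 2 : ℝ) ^ n • x ∈ U := by
    have h : Tendsto (fun n : ℕ => (1 / 2 : ℝ) ^ n • x) atTop (𝓝 ((0 : ℝ) • x)) :=
      (tendsto_pow_atTop_nhds_zero_of_lt_one (by norm_num) (by norm_num)).smul_const x
    rw [zero_smul] at h
    exact h hU0
  choose N hN using fun x => (hsmall x).exists
  -- `2 ^ n • f (2⁻ⁿ • x)` is independent of `n` as long as `2⁻ⁿ • x ∈ U`.
  have hindep {x : E} {m n : ℕ} (hmn : m ≤ n) (hm : (1 / 2 : ℝ) ^ m • x ∈ U) :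
      (2 : ℝ) ^ n • f ((1 / 2 : ℝ) ^ n • x) = (2 : ℝ) ^ m • f ((1 / 2 : ℝ) ^ m • x) := by
    obtain ⟨j, rfl⟩ := Nat.exists_eq_add_of_le hmn
    rw [add_comm m j, pow_add (1 / 2 : ℝ), mul_smul, map_half_pow_smul_of_add hU hadd hm,
      smul_smul, pow_add, mul_right_comm, ← mul_pow]
    norm_num
  refine ⟨.mk' (fun x => (2 : ℝ) ^ N x • f ((1 / 2 : ℝ) ^ N x • x)) fun x y => ?_, fun x hx => ?_⟩
  · obtain ⟨n, hx, hy, hxy, hnx, hny, hnxy⟩ := ((hsmall x).and ((hsmall y).and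
      ((hsmall (x + y)).and ((eventually_ge_atTop (N x)).and ((eventually_ge_atTop (N y)).and
        (eventually_ge_atTop (N (x + y)))))))).exists
    rw [← hindep hnx (hN x), ← hindep hny (hN y), ← hindep hnxy (hN (x + y)), smul_add,
      hadd _ hx _ hy (by rwa [← smul_add]), smul_add]
  · simpa using (hindep (Nat.zero_le (N x)) (by simpa using hx)).symm

theorem exists_continuousLinearMap_eqOn_of_add [IsTopologicalAddGroup E] [TopologicalSpace F]
    [IsTopologicalAddGroup F] [ContinuousSMul ℝ F] [T2Space F] (hU0 : U ∈ 𝓝 0)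
    (hU : StarConvex ℝ 0 U) (hf : ContinuousAt f 0)
    (hadd : ∀ x ∈ U, ∀ y ∈ U, x + y ∈ U → f (x + y) = f x + f y) :
    ∃ g : E →L[ℝ] F, Set.EqOn f g U := by
  obtain ⟨g, hg⟩ := exists_addMonoidHom_eqOn_of_add hU0 hU hadd
  have hgc : Continuous g :=
    continuous_of_continuousAt_zero g (hf.congr (hg.eventuallyEq_of_mem hU0))
  exact ⟨g.toRealLinearMap hgc, hg⟩

end Additive

/-! ### The quadratic forms and symmetric convex bodies -/

section FormBounds

variable {G : Type*} [AddCommGroup G] [MeasurableSpace G] [MeasurableAdd₂ G] [MeasurableNeg G]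
  {μ : Measure G} [μ.IsNegInvariant] {B : Set G} [IsFiniteMeasure (μ.restrict B)]
  (hB : MeasurableSet B) (hs : ∀ x, -x ∈ B ↔ x ∈ B) (k : ℕ) {f : G → ℝ} (hf : BddMeas f)
include hB hs hf

theorem convForm_le_weightedSq : convForm μ B k f ≤ weightedSq μ B (k + 1) f := by
  have h : 0 ≤ ∫ x in B, ∫ y in B, (f x - f y) ^ 2 * convPow μ B k (x - y) ∂μ ∂μ :=
    integral_nonneg fun x => integral_nonneg fun y =>
      mul_nonneg (sq_nonneg _) (convPow_nonneg μ B k _)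
  rw [integral_sub_sq_mul_convPow_sub hB hs k hf] at h
  linarith

theorem convForm_eq_weightedSq_of_eqOn_const {b : ℝ} (hb : ∀ x ∈ B, f x = b) :
    convForm μ B k f = weightedSq μ B (k + 1) f := by
  have h : ∫ x in B, ∫ y in B, (f x - f y) ^ 2 * convPow μ B k (x - y) ∂μ ∂μ = 0 :=
    setIntegral_eq_zero_of_forall_eq_zero fun x hx =>
      setIntegral_eq_zero_of_forall_eq_zero fun y hy => by simp [hb x hx, hb y hy]
  rw [integral_sub_sq_mul_convPow_sub hB hs k hf] at h
  linarith

variable [SFinite μ] [μ.IsAddLeftInvariant] (hodd : ∀ x, f (-x) = -f x)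
include hodd

theorem mul_convForm_le_weightedSq :
    (k + 3) * convForm μ B (k + 1) f ≤ weightedSq μ B (k + 2) f := by
  have h : 0 ≤ ∫ x, additiveDefect f x ^ 2 * convPow μ B 0 (∑ i, x i)
      ∂Measure.pi (fun _ : Fin (k + 3) => μ.restrict B) :=
    integral_nonneg fun x => mul_nonneg (sq_nonneg _) (convPow_nonneg μ B 0 _)
  rw [integral_additiveDefect_sq hB k hf hs hodd] at h
  linarith [nonneg_of_mul_nonneg_right h (by positivity)]

theorem mul_convForm_eq_weightedSq_of_eqOn_addMonoidHom {g : G →+ ℝ} (hg : Set.EqOn f g B) :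
    (k + 3) * convForm μ B (k + 1) f = weightedSq μ B (k + 2) f := by
  have h : ∫ x, additiveDefect f x ^ 2 * convPow μ B 0 (∑ i, x i)
      ∂Measure.pi (fun _ : Fin (k + 3) => μ.restrict B) = 0 := by
    refine integral_eq_zero_of_ae ?_
    have hmem : ∀ᵐ x ∂Measure.pi (fun _ : Fin (k + 3) => μ.restrict B), ∀ i, x i ∈ B :=
      ae_all_iff.mpr fun i => (Measure.quasiMeasurePreserving_eval _ i).ae (ae_restrict_mem hB)
    filter_upwards [hmem] with x hx
    by_cases hsum : ∑ i, x i ∈ B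
    · simp [additiveDefect, hg hsum, fun i => hg (hx i)]
    · simp [convPow, hsum]
  rw [integral_additiveDefect_sq hB k hf hs hodd] at h
  linarith [(mul_eq_zero.mp h).resolve_left (by positivity)]

end FormBounds

/-- A symmetric convex body: a compact convex set with nonempty interior that is invariant under
`x ↦ -x`. -/
structure SymmConvexBody (V : Type*) [NormedAddCommGroup V] [NormedSpace ℝ V] where
  carrier : Set V
  isCompact : IsCompact carrier
  convex : Convex ℝ carrier
  neg_mem_iff : ∀ x, -x ∈ carrier ↔ x ∈ carrier
  interior_nonempty : (interior carrier).Nonempty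

namespace SymmConvexBody

section Basic

variable {V : Type*} [NormedAddCommGroup V] [NormedSpace ℝ V]

instance : Coe (SymmConvexBody V) (Set V) := ⟨carrier⟩

variable (B : SymmConvexBody V)

theorem neg_mem_interior {x : V} (hx : x ∈ interior (B : Set V)) : -x ∈ interior (B : Set V) := by
  have hpre : Neg.neg ⁻¹' (B : Set V) = B := Set.ext B.neg_mem_iff
  rwa [← hpre, ← Homeomorph.coe_neg, ← (Homeomorph.neg V).preimage_interior] at hx

theorem half_sub_mem_interior {x y : V} (hx : x ∈ interior (B : Set V))
    (hy : y ∈ interior (B : Set V)) : (2⁻¹ : ℝ) • (x - y) ∈ interior (B : Set V) := by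
  rw [sub_eq_add_neg, smul_add]
  exact B.convex.interior hx (B.neg_mem_interior hy) (by norm_num) (by norm_num) (by norm_num)

theorem zero_mem_interior : 0 ∈ interior (B : Set V) := by
  obtain ⟨x, hx⟩ := B.interior_nonempty
  simpa using B.half_sub_mem_interior hx hx

theorem smul_mem_interior {t : ℝ} (ht₀ : 0 ≤ t) (ht₁ : t < 1) {x : V} (hx : x ∈ (B : Set V)) :
    t • x ∈ interior (B : Set V) := by
  simpa using B.convex.combo_interior_self_mem_interior B.zero_mem_interior hx
    (sub_pos.mpr ht₁) ht₀ (sub_add_cancel 1 t)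

variable [MeasurableSpace V] [BorelSpace V]

theorem measurableSet : MeasurableSet (B : Set V) := B.isCompact.measurableSet

instance instIsFiniteMeasureRestrict (μ : Measure V) [IsFiniteMeasureOnCompacts μ] :
    IsFiniteMeasure (μ.restrict B) :=
  isFiniteMeasure_restrict.mpr B.isCompact.measure_lt_top.ne

theorem measurePreserving_neg (μ : Measure V) [μ.IsNegInvariant] :
    MeasurePreserving (fun x => -x) (μ.restrict B) (μ.restrict B) := by
  have hpre : (fun x => -x) ⁻¹' (B : Set V) = B := Set.ext B.neg_mem_iff
  simpa only [hpre] using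
    (Measure.measurePreserving_neg μ).restrict_preimage B.measurableSet

end Basic

variable {V : Type*} [NormedAddCommGroup V] [NormedSpace ℝ V] [FiniteDimensional ℝ V]
  [MeasurableSpace V] [BorelSpace V] (μ : Measure V) [μ.IsAddHaarMeasure] (B : SymmConvexBody V)

theorem ae_mem_interior : ∀ᵐ x ∂μ.restrict B, x ∈ interior (B : Set V) := by
  have hfr := measure_eq_zero_iff_ae_notMem.mp (B.convex.addHaar_frontier μ)
  filter_upwards [ae_restrict_mem B.measurableSet, ae_restrict_of_ae hfr] with x hx hx'
  rw [← self_sdiff_frontier]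
  exact ⟨hx, hx'⟩

theorem continuous_convPow_succ (k : ℕ) : Continuous (convPow μ B (k + 1)) :=
  BallSpectral.continuous_convPow_succ B.measurableSet (B.convex.addHaar_frontier μ) k

theorem convPow_pos_of_inv_smul_mem_interior {k : ℕ} {x : V}
    (hx : ((k : ℝ) + 1)⁻¹ • x ∈ interior (B : Set V)) : 0 < convPow μ B k x := by
  have h := convPow_pos (μ := μ) B.measurableSet k hx
  rwa [smul_inv_smul₀ (by positivity)] at h

theorem convPow_succ_pos (k : ℕ) {x : V} (hx : x ∈ (B : Set V)) : 0 < convPow μ B (k + 1) x := by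
  refine B.convPow_pos_of_inv_smul_mem_interior μ (B.smul_mem_interior (by positivity) ?_ hx)
  push_cast
  exact inv_lt_one_of_one_lt₀ (by linarith [k.cast_nonneg (α := ℝ)])

theorem convPow_succ_sub_pos (k : ℕ) {x y : V} (hx : x ∈ interior (B : Set V))
    (hy : y ∈ interior (B : Set V)) : 0 < convPow μ B (k + 1) (x - y) := by
  have hstar : StarConvex ℝ 0 (interior (B : Set V)) :=
    B.convex.interior.starConvex B.zero_mem_interior
  have ht : 2 * (((k + 1 : ℕ) : ℝ) + 1)⁻¹ ≤ 1 := by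
    rw [← div_eq_mul_inv, div_le_one (by positivity)]
    push_cast
    linarith [k.cast_nonneg (α := ℝ)]
  have h := hstar.smul_mem (B.half_sub_mem_interior hx hy) (by positivity) ht
  rw [smul_smul, mul_right_comm, mul_inv_cancel₀ two_ne_zero, one_mul] at h
  exact B.convPow_pos_of_inv_smul_mem_interior μ h

end SymmConvexBody

section EqualityCases

variable {V : Type*} [NormedAddCommGroup V] [NormedSpace ℝ V] [FiniteDimensional ℝ V]
  [MeasurableSpace V] [BorelSpace V] {μ : Measure V} [μ.IsAddHaarMeasure] {B : SymmConvexBody V}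
  {k : ℕ} {f : V → ℝ} (hf : BddMeas f) (hc : ContinuousOn f (interior (B : Set V)))
include hf hc

theorem eq_of_convForm_eq_weightedSq (h : convForm μ B (k + 1) f = weightedSq μ B (k + 2) f)
    {x y : V} (hx : x ∈ interior (B : Set V)) (hy : y ∈ interior (B : Set V)) : f x = f y := by
  have hint : Integrable (fun p : V × V => (f p.1 - f p.2) ^ 2 * convPow μ B (k + 1) (p.1 - p.2))
      ((μ.restrict B).prod (μ.restrict B)) :=
    BddMeas.integrable_mul_convPow_sub B.measurableSet (k + 1)
      (((hf.comp measurable_fst).sub (hf.comp measurable_snd)).pow 2)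
  have hzero := integral_prod _ hint
  rw [integral_sub_sq_mul_convPow_sub B.measurableSet B.neg_mem_iff (k + 1) hf, h, sub_self,
    mul_zero, integral_eq_zero_iff_of_nonneg
    (fun p => mul_nonneg (sq_nonneg _) (convPow_nonneg _ _ _ _)) hint,
    Measure.prod_restrict] at hzero
  let U : Set (V × V) := interior (B : Set V) ×ˢ interior (B : Set V)
  have hU : IsOpen U := isOpen_interior.prod isOpen_interior
  have hae : (fun p : V × V => f p.1) =ᵐ[(μ.prod μ).restrict U] fun p => f p.2 := by
    filter_upwards [ae_restrict_mem hU.measurableSet, ae_restrict_of_ae_restrict_of_subset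
      (Set.prod_mono interior_subset interior_subset) hzero] with p hpU hp
    have hpos := B.convPow_succ_sub_pos μ k hpU.1 hpU.2
    exact sub_eq_zero.mp (sq_eq_zero_iff.mp ((mul_eq_zero.mp hp).resolve_right hpos.ne'))
  exact Measure.eqOn_open_of_ae_eq hae hU (hc.comp continuousOn_fst fun p hp => hp.1)
    (hc.comp continuousOn_snd fun p hp => hp.2) (x := (x, y)) ⟨hx, hy⟩

variable (hodd : ∀ x, f (-x) = -f x)
  (h : (k + 3) * convForm μ B (k + 1) f = weightedSq μ B (k + 2) f)
include hodd h

theorem additiveDefect_eq_zero_of_mul_convForm_eq {x : Fin (k + 3) → V}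
    (hx : ∀ i, x i ∈ interior (B : Set V)) (hsum : ∑ i, x i ∈ interior (B : Set V)) :
    additiveDefect f x = 0 := by
  have hzero := integral_additiveDefect_sq B.measurableSet k hf B.neg_mem_iff hodd (μ := μ)
  rw [h, sub_self, mul_zero, integral_eq_zero_iff_of_nonneg
    (fun p => mul_nonneg (sq_nonneg _) (convPow_nonneg _ _ _ _))
    ((((hf.additiveDefect _).pow 2).mul
      ((bddMeas_convPow μ B.measurableSet 0).comp_sum _)).integrable _),
    ← Measure.restrict_pi_pi] at hzero
  let U : Set (Fin (k + 3) → V) := (Set.univ.pi fun _ => interior (B : Set V)) ∩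
    (fun x => ∑ i, x i) ⁻¹' interior (B : Set V)
  have hsumc : Continuous fun x : Fin (k + 3) → V => ∑ i, x i := by fun_prop
  have hU : IsOpen U := (isOpen_set_pi Set.finite_univ fun _ _ => isOpen_interior).inter
    (isOpen_interior.preimage hsumc)
  have hae : additiveDefect f =ᵐ[(Measure.pi fun _ => μ).restrict U] fun _ => 0 := by
    filter_upwards [ae_restrict_mem hU.measurableSet, ae_restrict_of_ae_restrict_of_subset
      (s := U) (fun y hy i hi => interior_subset (hy.1 i hi)) hzero] with y hyU hy
    have hB : convPow μ B 0 (∑ i, y i) ≠ 0 := by simp [convPow, interior_subset hyU.2]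
    exact sq_eq_zero_iff.mp ((mul_eq_zero.mp hy).resolve_right hB)
  have hcont : ContinuousOn (additiveDefect f) U :=
    (continuousOn_finsetSum _ fun i _ => hc.comp (continuous_apply i).continuousOn
      fun y hy => hy.1 i (Set.mem_univ i)).sub (hc.comp hsumc.continuousOn fun y hy => hy.2)
  exact Measure.eqOn_open_of_ae_eq hae hU hcont continuousOn_const ⟨fun i _ => hx i, hsum⟩

theorem exists_continuousLinearMap_eqOn_of_mul_convForm_eq :
    ∃ a : V →L[ℝ] ℝ, Set.EqOn f a (interior (B : Set V)) := by
  have hnhds := isOpen_interior.mem_nhds B.zero_mem_interior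
  refine exists_continuousLinearMap_eqOn_of_add hnhds
    (B.convex.interior.starConvex B.zero_mem_interior) (hc.continuousAt hnhds)
    fun x hx y hy hxy => ?_
  have hf0 : f 0 = 0 := self_eq_neg.mp (by simpa using hodd 0)
  have hdefect := additiveDefect_eq_zero_of_mul_convForm_eq hf hc hodd h
    (x := Fin.cons x (Fin.cons y 0))
    (Fin.cases hx (Fin.cases hy fun _ => B.zero_mem_interior))
    (by simpa [Fin.sum_univ_succ] using hxy)
  simpa [additiveDefect, Fin.sum_univ_succ, hf0, sub_eq_zero, eq_comm] using hdefect

end EqualityCases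

/-! ### The operator on `L²` of a symmetric convex body -/

theorem bddMeas_indicator_of_isCompact {α : Type*} [TopologicalSpace α] [T2Space α]
    [MeasurableSpace α] [OpensMeasurableSpace α] {s : Set α} (hs : IsCompact s) {F : α → ℝ}
    (hF : ContinuousOn F s) : BddMeas (s.indicator F) := by
  classical
  obtain ⟨C, hC⟩ := hs.exists_bound_of_continuousOn hF
  refine ⟨?_, max C 0, fun x => ?_⟩
  · rw [← Set.piecewise_eq_indicator]
    exact hF.measurable_piecewise continuousOn_const hs.measurableSet
  · by_cases hx : x ∈ s
    · simpa [hx] using Or.inl (hC x hx)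
    · simp [hx]

section ConvOp

variable {V : Type*} [NormedAddCommGroup V] [NormedSpace ℝ V] [MeasurableSpace V] (μ : Measure V)
  (B : SymmConvexBody V) (k : ℕ)

/-- The weight `K_q^{1/2}` with `q = k + 4`: for an even exponent `K_q` is the convolution power
`convPow μ B (k + 2)`. -/
def weight (x : V) : ℝ := √(convPow μ B (k + 2) x)

/-- The function `K_q^{-1/2} 1_B` with `q = k + 4`. -/
def invWeight : V → ℝ := (B : Set V).indicator fun x => (weight μ B k x)⁻¹

theorem weight_sq (x : V) : weight μ B k x ^ 2 = convPow μ B (k + 2) x :=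
  Real.sq_sqrt (convPow_nonneg μ B _ x)

theorem invWeight_of_mem {x : V} (hx : x ∈ (B : Set V)) :
    invWeight μ B k x = (weight μ B k x)⁻¹ := Set.indicator_of_mem hx _

/-- The function `(K_q^{-1/2} h 1_B) * L_q` with `q = k + 4`. -/
def potential (h : V → ℝ) : V → ℝ :=
  ((B : Set V).indicator fun y => (weight μ B k y)⁻¹ * h y)
    ⋆[ContinuousLinearMap.mul ℝ ℝ, μ] convPow μ B (k + 1)

variable [BorelSpace V]

theorem potential_eq_setIntegral (h : V → ℝ) (x : V) : potential μ B k h x =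
    ∫ y in B, invWeight μ B k y * convPow μ B (k + 1) (x - y) * h y ∂μ := by
  rw [potential, convolution_def, ← integral_indicator B.measurableSet]
  congr with y
  by_cases hy : y ∈ (B : Set V)
  · simp only [Set.indicator_of_mem hy, ContinuousLinearMap.mul_apply', invWeight_of_mem μ B k hy]
    ring
  · simp [hy]

variable [FiniteDimensional ℝ V] [μ.IsAddHaarMeasure]

theorem weight_pos {x : V} (hx : x ∈ (B : Set V)) : 0 < weight μ B k x :=
  Real.sqrt_pos.mpr (B.convPow_succ_pos μ (k + 1) hx)

theorem weight_neg (x : V) : weight μ B k (-x) = weight μ B k x := by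
  rw [weight, convPow_neg μ B.neg_mem_iff, weight]

theorem continuous_weight : Continuous (weight μ B k) :=
  (B.continuous_convPow_succ μ (k + 1)).sqrt

theorem continuousOn_inv_weight : ContinuousOn (fun x => (weight μ B k x)⁻¹) B :=
  (continuous_weight μ B k).continuousOn.inv₀ fun _ hx => (weight_pos μ B k hx).ne'

theorem bddMeas_weight : BddMeas (weight μ B k) := by
  obtain ⟨-, C, hC⟩ := bddMeas_convPow μ B.measurableSet (k + 2)
  refine ⟨(continuous_weight μ B k).measurable, √C, fun x => ?_⟩
  rw [weight, Real.norm_of_nonneg (Real.sqrt_nonneg _)]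
  exact Real.sqrt_le_sqrt ((le_abs_self _).trans (hC x))

theorem bddMeas_invWeight : BddMeas (invWeight μ B k) :=
  bddMeas_indicator_of_isCompact B.isCompact (continuousOn_inv_weight μ B k)

theorem invWeight_neg (x : V) : invWeight μ B k (-x) = invWeight μ B k x := by
  classical
  simp only [invWeight, Set.indicator_apply, B.neg_mem_iff, weight_neg]

/-- The kernel `K_q(x)^{-1/2} L_q(x - y) K_q(y)^{-1/2}` of `T_q` with `q = k + 4`: for an even
exponent `L_q` is the convolution power `convPow μ B (k + 1)`. -/
def convKernel (p : V × V) : ℝ :=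
  invWeight μ B k p.1 * invWeight μ B k p.2 * convPow μ B (k + 1) (p.1 - p.2)

theorem bddMeas_convKernel : BddMeas (convKernel μ B k) :=
  (((bddMeas_invWeight μ B k).comp measurable_fst).mul
    ((bddMeas_invWeight μ B k).comp measurable_snd)).mul
    ((bddMeas_convPow μ B.measurableSet (k + 1)).comp (measurable_fst.sub measurable_snd))

theorem convKernel_symm (x y : V) : convKernel μ B k (x, y) = convKernel μ B k (y, x) := by
  simp only [convKernel, convPow_sub_comm μ B.neg_mem_iff _ x y,
    mul_comm (invWeight μ B k x) (invWeight μ B k y)]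

theorem convKernel_neg (x y : V) : convKernel μ B k (-x, -y) = convKernel μ B k (x, y) := by
  simp only [convKernel, invWeight_neg, neg_sub_neg, convPow_sub_comm μ B.neg_mem_iff _ y x]

/-- The operator `T_q` on `L²(B)` with `q = k + 4`. -/
def convOp : Lp ℝ 2 (μ.restrict (B : Set V)) →L[ℝ] Lp ℝ 2 (μ.restrict (B : Set V)) :=
  integralOp (μ.restrict B) (bddMeas_convKernel μ B k)

variable {k}

theorem continuous_potential (h : Lp ℝ 2 (μ.restrict (B : Set V))) :
    Continuous (potential μ B k h) := by
  obtain ⟨-, C, hC⟩ := bddMeas_convPow μ B.measurableSet (k + 1)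
  have hint : Integrable ((B : Set V).indicator fun y => (weight μ B k y)⁻¹ * h y) μ := by
    refine (integrable_indicator_iff B.measurableSet).mpr
      (((bddMeas_invWeight μ B k).integrable_mul (integrable_of_Lp_two h)).congr ?_)
    filter_upwards [ae_restrict_mem B.measurableSet] with y hy
    rw [invWeight_of_mem μ B k hy]
  exact BddAbove.continuous_convolution_right_of_integrable _
    ⟨C, Set.forall_mem_range.mpr hC⟩ hint (B.continuous_convPow_succ μ k)

theorem convOp_ae_eq (h : Lp ℝ 2 (μ.restrict (B : Set V))) :
    convOp μ B k h =ᵐ[μ.restrict B] fun x => (weight μ B k x)⁻¹ * potential μ B k h x := by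
  filter_upwards [integralOp_ae_eq (bddMeas_convKernel μ B k) h,
    ae_restrict_mem B.measurableSet] with x hx hxB
  rw [convOp, hx, potential_eq_setIntegral, ← integral_const_mul]
  simp only [convKernel, invWeight_of_mem μ B k hxB, mul_assoc]

theorem isCompactOperator_convOp : IsCompactOperator (convOp μ B k) :=
  isCompactOperator_integralOp _

theorem isSymmetric_convOp : (convOp μ B k).IsSymmetric :=
  isSymmetric_integralOp _ (convKernel_symm μ B k)

/-- The reflection `h ↦ (x ↦ h(-x))` on `L²(B)`. -/
def reflect : Lp ℝ 2 (μ.restrict (B : Set V)) →ₗᵢ[ℝ] Lp ℝ 2 (μ.restrict (B : Set V)) :=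
  Lp.compMeasurePreservingₗᵢ ℝ (fun x => -x) (B.measurePreserving_neg μ)

theorem reflect_ae_eq (h : Lp ℝ 2 (μ.restrict (B : Set V))) :
    reflect μ B h =ᵐ[μ.restrict B] fun x => h (-x) :=
  Lp.coeFn_compMeasurePreserving h (B.measurePreserving_neg μ)

theorem reflect_reflect (h : Lp ℝ 2 (μ.restrict (B : Set V))) :
    reflect μ B (reflect μ B h) = h := by
  refine Lp.ext ?_
  filter_upwards [reflect_ae_eq μ B (reflect μ B h),
    (B.measurePreserving_neg μ).quasiMeasurePreserving.ae (reflect_ae_eq μ B h)] with x h₁ h₂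
  rw [h₁, h₂, neg_neg]

theorem convOp_reflect (h : Lp ℝ 2 (μ.restrict (B : Set V))) :
    convOp μ B k (reflect μ B h) = reflect μ B (convOp μ B k h) :=
  integralOp_compMeasurePreserving (bddMeas_convKernel μ B k) (MeasurableEquiv.neg V)
    (B.measurePreserving_neg μ) (convKernel_neg μ B k) h

end ConvOp

theorem BddMeas.oddPart {G : Type*} [Neg G] [MeasurableSpace G] [MeasurableNeg G] {f : G → ℝ}
    (hf : BddMeas f) : BddMeas fun x => (1 / 2 : ℝ) * (f x - f (-x)) :=
  (BddMeas.const _).mul (hf.sub (hf.comp measurable_neg))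

section WeightedLp

variable {V : Type*} [NormedAddCommGroup V] [NormedSpace ℝ V] [FiniteDimensional ℝ V]
  [MeasurableSpace V] [BorelSpace V] {μ : Measure V} [μ.IsAddHaarMeasure] {B : SymmConvexBody V}
  {k : ℕ} {f g : V → ℝ}

/-- The element `K_q^{1/2} f` of `L²(B)` with `q = k + 4`. These are the functions on which the
quadratic form of `T_q` loses its weights. -/
def weightedLp (μ : Measure V) [μ.IsAddHaarMeasure] (B : SymmConvexBody V) (k : ℕ) {f : V → ℝ}
    (hf : BddMeas f) : Lp ℝ 2 (μ.restrict (B : Set V)) :=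
  (((bddMeas_weight μ B k).mul hf).memLp 2 (μ.restrict B)).toLp

theorem weightedLp_ae_eq (hf : BddMeas f) :
    weightedLp μ B k hf =ᵐ[μ.restrict B] fun x => weight μ B k x * f x :=
  MemLp.coeFn_toLp _

theorem eq_weightedLp {h : Lp ℝ 2 (μ.restrict (B : Set V))} (hf : BddMeas f)
    (hh : h =ᵐ[μ.restrict B] fun x => weight μ B k x * f x) : h = weightedLp μ B k hf :=
  Lp.ext (hh.trans (weightedLp_ae_eq hf).symm)

theorem weightedLp_congr (hf : BddMeas f) (hg : BddMeas g)
    (hfg : Set.EqOn f g (interior (B : Set V))) :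
    weightedLp μ B k hf = weightedLp μ B k hg := by
  refine eq_weightedLp hg ?_
  filter_upwards [weightedLp_ae_eq hf, B.ae_mem_interior μ] with x hx hxB
  rw [hx, hfg hxB]

theorem weightedLp_add (hf : BddMeas f) (hg : BddMeas g) :
    weightedLp μ B k (hf.add hg) = weightedLp μ B k hf + weightedLp μ B k hg := by
  refine (eq_weightedLp _ ?_).symm
  filter_upwards [Lp.coeFn_add (weightedLp μ B k hf) (weightedLp μ B k hg),
    weightedLp_ae_eq (k := k) hf, weightedLp_ae_eq (k := k) hg] with x h₁ h₂ h₃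
  rw [h₁, Pi.add_apply, h₂, h₃, mul_add]

theorem reflect_weightedLp (hf : BddMeas f) :
    reflect μ B (weightedLp μ B k hf) = weightedLp μ B k (hf.comp measurable_neg) := by
  refine eq_weightedLp _ ?_
  filter_upwards [reflect_ae_eq μ B (weightedLp μ B k hf),
    (B.measurePreserving_neg μ).quasiMeasurePreserving.ae (weightedLp_ae_eq (k := k) hf)]
    with x h₁ h₂
  rw [h₁, h₂, weight_neg]

theorem oddPart_weightedLp (hf : BddMeas f) :
    oddPart (reflect μ B) (weightedLp μ B k hf) = weightedLp μ B k hf.oddPart := by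
  refine eq_weightedLp _ ?_
  rw [BallSpectral.oddPart, reflect_weightedLp]
  filter_upwards [Lp.coeFn_smul (1 / 2 : ℝ)
      (weightedLp μ B k hf - weightedLp μ B k (hf.comp measurable_neg)),
    Lp.coeFn_sub (weightedLp μ B k hf) (weightedLp μ B k (hf.comp measurable_neg)),
    weightedLp_ae_eq (k := k) hf, weightedLp_ae_eq (k := k) (hf.comp measurable_neg)]
    with x h₁ h₂ h₃ h₄
  rw [h₁, Pi.smul_apply, h₂, Pi.sub_apply, h₃, h₄, smul_eq_mul]
  ring

theorem dense_range_weightedLp (μ : Measure V) [μ.IsAddHaarMeasure] (B : SymmConvexBody V)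
    (k : ℕ) : Dense {h | ∃ (f : V → ℝ) (hf : BddMeas f), h = weightedLp μ B k hf} := by
  refine (BoundedContinuousFunction.toLp_denseRange (E := ℝ) (𝕜 := ℝ) (μ := μ.restrict B)
    (p := 2) ENNReal.ofNat_ne_top).mono ?_
  rintro _ ⟨g, rfl⟩
  have hg : BddMeas g := ⟨g.continuous.measurable, ‖g‖, g.norm_coe_le_norm⟩
  refine ⟨_, (bddMeas_invWeight μ B k).mul hg, eq_weightedLp _ ?_⟩
  filter_upwards [BoundedContinuousFunction.coeFn_toLp (p := 2) (𝕜 := ℝ) (μ.restrict B) g,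
    ae_restrict_mem B.measurableSet] with x hx hxB
  rw [hx, invWeight_of_mem μ B k hxB, mul_inv_cancel_left₀ (weight_pos μ B k hxB).ne']

theorem inner_weightedLp_self (hf : BddMeas f) :
    inner ℝ (weightedLp μ B k hf) (weightedLp μ B k hf) = weightedSq μ B (k + 2) f := by
  rw [inner_Lp_two_eq_integral, weightedSq]
  refine integral_congr_ae ?_
  filter_upwards [weightedLp_ae_eq (k := k) hf] with x hx
  rw [hx, ← weight_sq]
  ring

theorem inner_convOp_weightedLp (hf : BddMeas f) :
    inner ℝ (weightedLp μ B k hf) (convOp μ B k (weightedLp μ B k hf)) =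
      convForm μ B (k + 1) f := by
  have h : ∀ᵐ x ∂μ.restrict B, invWeight μ B k x * weightedLp μ B k hf x = f x := by
    filter_upwards [weightedLp_ae_eq hf, ae_restrict_mem B.measurableSet] with x hx hxB
    rw [hx, invWeight_of_mem μ B k hxB, inv_mul_cancel_left₀ (weight_pos μ B k hxB).ne']
  rw [convOp, inner_integralOp, convForm]
  refine integral_congr_ae ?_
  filter_upwards [h] with x hx
  refine integral_congr_ae ?_
  filter_upwards [h] with y hy
  rw [convKernel, ← hx, ← hy]
  ring

theorem inner_sub_smul_convOp_weightedLp (m : ℝ) (hf : BddMeas f) :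
    inner ℝ (weightedLp μ B k hf) (weightedLp μ B k hf - m • convOp μ B k (weightedLp μ B k hf)) =
      weightedSq μ B (k + 2) f - m * convForm μ B (k + 1) f := by
  rw [inner_sub_right, inner_smul_right, inner_weightedLp_self, inner_convOp_weightedLp]

theorem exists_weightedLp_of_smul_convOp_eq {m : ℝ} {h : Lp ℝ 2 (μ.restrict (B : Set V))}
    (hh : m • convOp μ B k h = h) :
    ∃ (f : V → ℝ) (hf : BddMeas f),
      ContinuousOn f (interior (B : Set V)) ∧ h = weightedLp μ B k hf := by
  let F : V → ℝ := fun x => (weight μ B k x)⁻¹ * ((weight μ B k x)⁻¹ * (m * potential μ B k h x))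
  have hF : ContinuousOn F B := (continuousOn_inv_weight μ B k).mul
    ((continuousOn_inv_weight μ B k).mul
      (continuousOn_const.mul (continuous_potential μ B h).continuousOn))
  refine ⟨(B : Set V).indicator F, bddMeas_indicator_of_isCompact B.isCompact hF,
    (hF.mono interior_subset).congr fun x hx => Set.indicator_of_mem (interior_subset hx) F,
    eq_weightedLp _ ?_⟩
  nth_rw 1 [← hh]
  filter_upwards [Lp.coeFn_smul m (convOp μ B k h), convOp_ae_eq μ B h,
    ae_restrict_mem B.measurableSet] with x h₁ h₂ hxB
  rw [h₁, Pi.smul_apply, h₂, smul_eq_mul, Set.indicator_of_mem hxB, mul_left_comm]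
  exact (mul_inv_cancel_left₀ (weight_pos μ B k hxB).ne' _).symm

theorem inner_sub_convOp_nonneg (h : Lp ℝ 2 (μ.restrict (B : Set V))) :
    0 ≤ inner ℝ h (h - convOp μ B k h) := by
  refine (dense_range_weightedLp μ B k).induction
    (P := fun h => 0 ≤ inner ℝ h (h - convOp μ B k h)) ?_ ?_ h
  · rintro _ ⟨f, hf, rfl⟩
    have hform := inner_sub_smul_convOp_weightedLp (μ := μ) (B := B) (k := k) 1 hf
    rw [one_smul, one_mul] at hform
    rw [hform, sub_nonneg]
    exact convForm_le_weightedSq B.measurableSet B.neg_mem_iff (k + 1) hf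
  · exact isClosed_le continuous_const (by fun_prop)

theorem inner_sub_smul_convOp_nonneg_of_odd {h : Lp ℝ 2 (μ.restrict (B : Set V))}
    (hodd : reflect μ B h = -h) : 0 ≤ inner ℝ h (h - (k + 3 : ℝ) • convOp μ B k h) := by
  suffices H : ∀ h, 0 ≤ inner ℝ (oddPart (reflect μ B) h)
      (oddPart (reflect μ B) h - (k + 3 : ℝ) • convOp μ B k (oddPart (reflect μ B) h)) by
    simpa only [oddPart_of_odd hodd] using H h
  refine fun h => (dense_range_weightedLp μ B k).induction (P := fun h =>
    0 ≤ inner ℝ (oddPart (reflect μ B) h)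
      (oddPart (reflect μ B) h - (k + 3 : ℝ) • convOp μ B k (oddPart (reflect μ B) h))) ?_ ?_ h
  · rintro _ ⟨f, hf, rfl⟩
    rw [oddPart_weightedLp, inner_sub_smul_convOp_weightedLp, sub_nonneg]
    exact mul_convForm_le_weightedSq B.measurableSet B.neg_mem_iff k hf.oddPart
      fun x => by rw [neg_neg]; ring
  · have hR := (reflect μ B).continuous
    unfold oddPart
    exact isClosed_le continuous_const (by fun_prop)

end WeightedLp

section AffineSubmodule

variable {V : Type*} [NormedAddCommGroup V] [NormedSpace ℝ V] [FiniteDimensional ℝ V]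
  [MeasurableSpace V] [BorelSpace V] (μ : Measure V) [μ.IsAddHaarMeasure] (B : SymmConvexBody V)
  (k : ℕ)

/-- The subspace `ℋ` of `L²(B)` of the functions `K_q(x)^{1/2} (a x + b)`, where `a` is a linear
form, `b` a constant and `q = k + 4`. -/
def affineSubmodule : Submodule ℝ (Lp ℝ 2 (μ.restrict (B : Set V))) where
  carrier := {h | ∃ (a : V →L[ℝ] ℝ) (b : ℝ), h =ᵐ[μ.restrict B] fun x => weight μ B k x * (a x + b)}
  zero_mem' := ⟨0, 0, (Lp.coeFn_zero _ _ _).trans (.of_eq (by ext; simp))⟩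
  add_mem' := by
    rintro g h ⟨a, b, hg⟩ ⟨a', b', hh⟩
    refine ⟨a + a', b + b', ?_⟩
    filter_upwards [Lp.coeFn_add g h, hg, hh] with x hx hgx hhx
    rw [hx, Pi.add_apply, hgx, hhx, add_apply]
    ring
  smul_mem' := by
    rintro c h ⟨a, b, hh⟩
    refine ⟨c • a, c * b, ?_⟩
    filter_upwards [Lp.coeFn_smul c h, hh] with x hx hhx
    rw [hx, Pi.smul_apply, hhx, smul_apply, smul_eq_mul, smul_eq_mul]
    ring

/-- The operator on `L²(B)` acting as `T_q` on even and as `(q - 1) T_q` on odd functions, where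
`q = k + 4`. -/
def gapOp : Lp ℝ 2 (μ.restrict (B : Set V)) →L[ℝ] Lp ℝ 2 (μ.restrict (B : Set V)) :=
  parityOp (reflect μ B) (k + 3) (convOp μ B k)

theorem isCompactOperator_gapOp : IsCompactOperator (gapOp μ B k) :=
  isCompactOperator_parityOp (isCompactOperator_convOp μ B)

theorem isPositive_one_sub_gapOp : (1 - gapOp μ B k).IsPositive :=
  isPositive_one_sub_parityOp (reflect_reflect μ B) (convOp_reflect μ B) (isSymmetric_convOp μ B)
    (fun h _ => inner_sub_convOp_nonneg h) fun _ hodd => inner_sub_smul_convOp_nonneg_of_odd hodd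

variable {μ B k}

theorem gapOp_eq_self_of_inner_eq_zero {h : Lp ℝ 2 (μ.restrict (B : Set V))}
    (hh : inner ℝ h (h - gapOp μ B k h) = 0) : gapOp μ B k h = h :=
  (sub_eq_zero.mp
    (apply_eq_zero_of_isPositive_of_inner_eq_zero (isPositive_one_sub_gapOp μ B k) hh)).symm

theorem gapOp_weightedLp_of_eqOn_const {f : V → ℝ} (hf : BddMeas f) {b : ℝ}
    (hb : Set.EqOn f (fun _ => b) B) : gapOp μ B k (weightedLp μ B k hf) = weightedLp μ B k hf := by
  have heven : reflect μ B (weightedLp μ B k hf) = weightedLp μ B k hf := by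
    rw [reflect_weightedLp]
    exact weightedLp_congr _ _ fun x hx =>
      (hb (interior_subset (B.neg_mem_interior hx))).trans (hb (interior_subset hx)).symm
  have hform := inner_sub_smul_convOp_weightedLp (μ := μ) (B := B) (k := k) 1 hf
  rw [one_smul, one_mul, convForm_eq_weightedSq_of_eqOn_const B.measurableSet B.neg_mem_iff _ hf hb,
    sub_self] at hform
  refine gapOp_eq_self_of_inner_eq_zero ?_
  rwa [gapOp, parityOp_of_even heven]

theorem gapOp_weightedLp_of_eqOn_linear {f : V → ℝ} (hf : BddMeas f) (hodd : ∀ x, f (-x) = -f x)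
    {a : V →L[ℝ] ℝ} (ha : Set.EqOn f a B) :
    gapOp μ B k (weightedLp μ B k hf) = weightedLp μ B k hf := by
  have hneg : reflect μ B (weightedLp μ B k hf) = -weightedLp μ B k hf := by
    rw [reflect_weightedLp, ← sub_eq_zero, sub_neg_eq_add, ← weightedLp_add]
    refine (eq_weightedLp _ ?_).symm
    refine (Lp.coeFn_zero _ _ _).trans (.of_eq ?_)
    ext x
    simp [hodd]
  refine gapOp_eq_self_of_inner_eq_zero ?_
  rw [gapOp, parityOp_of_odd hneg, inner_sub_smul_convOp_weightedLp,
    mul_convForm_eq_weightedSq_of_eqOn_addMonoidHom B.measurableSet B.neg_mem_iff k hf hodd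
      (g := (a : V →+ ℝ)) ha, sub_self]

theorem weightedLp_mem_affineSubmodule {f : V → ℝ} (hf : BddMeas f) {a : V →L[ℝ] ℝ} {b : ℝ}
    (hab : ∀ x ∈ interior (B : Set V), f x = a x + b) :
    weightedLp μ B k hf ∈ affineSubmodule μ B k := by
  refine ⟨a, b, ?_⟩
  filter_upwards [weightedLp_ae_eq hf, B.ae_mem_interior μ] with x hx hxB
  rw [hx, hab x hxB]

theorem mem_affineSubmodule_of_convOp_eq_self {h : Lp ℝ 2 (μ.restrict (B : Set V))}
    (hh : convOp μ B k h = h) : h ∈ affineSubmodule μ B k := by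
  obtain ⟨f, hf, hc, rfl⟩ := exists_weightedLp_of_smul_convOp_eq ((one_smul ℝ _).trans hh)
  have hform : convForm μ B (k + 1) f = weightedSq μ B (k + 2) f := by
    rw [← inner_convOp_weightedLp hf, hh, inner_weightedLp_self]
  refine weightedLp_mem_affineSubmodule hf (a := 0) (b := f 0) fun x hx => ?_
  rw [eq_of_convForm_eq_weightedSq hf hc hform hx B.zero_mem_interior,
    zero_apply, zero_add]

theorem mem_affineSubmodule_of_odd_of_smul_convOp_eq {h : Lp ℝ 2 (μ.restrict (B : Set V))}
    (hodd : reflect μ B h = -h) (hh : (k + 3 : ℝ) • convOp μ B k h = h) :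
    h ∈ affineSubmodule μ B k := by
  obtain ⟨f, hf, hc, hhf⟩ := exists_weightedLp_of_smul_convOp_eq hh
  obtain rfl : h = weightedLp μ B k hf.oddPart := by
    rw [← oddPart_weightedLp hf, ← hhf, oddPart_of_odd hodd]
  have hc' : ContinuousOn (fun x => (1 / 2 : ℝ) * (f x - f (-x))) (interior (B : Set V)) :=
    continuousOn_const.mul
      (hc.sub (hc.comp continuousOn_neg fun _ hx => B.neg_mem_interior hx))
  have hform := inner_sub_smul_convOp_weightedLp (μ := μ) (B := B) (k := k) (k + 3) hf.oddPart
  rw [hh, sub_self, inner_zero_right] at hform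
  obtain ⟨a, ha⟩ := exists_continuousLinearMap_eqOn_of_mul_convForm_eq hf.oddPart hc'
    (fun x => by rw [neg_neg]; ring) (sub_eq_zero.mp hform.symm).symm
  exact weightedLp_mem_affineSubmodule _ (b := 0) fun x hx => (ha hx).trans (add_zero _).symm

theorem gapOp_eq_self_of_mem_affineSubmodule {h : Lp ℝ 2 (μ.restrict (B : Set V))}
    (hh : h ∈ affineSubmodule μ B k) : gapOp μ B k h = h := by
  classical
  obtain ⟨a, b, hab⟩ := hh
  have ha : BddMeas ((B : Set V).indicator a) :=
    bddMeas_indicator_of_isCompact B.isCompact a.continuous.continuousOn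
  have hb : BddMeas ((B : Set V).indicator fun _ => b) :=
    bddMeas_indicator_of_isCompact B.isCompact continuousOn_const
  have hodd (x : V) : (B : Set V).indicator a (-x) = -(B : Set V).indicator a x := by
    by_cases hx : x ∈ (B : Set V) <;> simp [hx, B.neg_mem_iff]
  obtain rfl : h = weightedLp μ B k ha + weightedLp μ B k hb := by
    rw [← weightedLp_add]
    refine eq_weightedLp _ ?_
    filter_upwards [hab, ae_restrict_mem B.measurableSet] with x hx hxB
    rw [hx, Set.indicator_of_mem hxB, Set.indicator_of_mem hxB]
  rw [map_add, gapOp_weightedLp_of_eqOn_linear ha hodd (Set.eqOn_indicator (f := a)),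
    gapOp_weightedLp_of_eqOn_const hb Set.eqOn_indicator]

theorem mem_affineSubmodule_iff {h : Lp ℝ 2 (μ.restrict (B : Set V))} :
    h ∈ affineSubmodule μ B k ↔ gapOp μ B k h = h := by
  refine ⟨gapOp_eq_self_of_mem_affineSubmodule, fun hh => ?_⟩
  obtain ⟨heven, hodd⟩ := eq_evenPart_and_eq_oddPart_of_parityOp_eq_self (reflect_reflect μ B)
    (convOp_reflect μ B) hh
  rw [← evenPart_add_oddPart (reflect μ B) h]
  exact add_mem (mem_affineSubmodule_of_convOp_eq_self heven)
    (mem_affineSubmodule_of_odd_of_smul_convOp_eq (map_oddPart (reflect_reflect μ B) h) hodd)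

instance instHasOrthogonalProjectionAffineSubmodule :
    (affineSubmodule μ B k).HasOrthogonalProjection := by
  have hset : (affineSubmodule μ B k : Set (Lp ℝ 2 (μ.restrict (B : Set V)))) =
      {h | gapOp μ B k h = h} := Set.ext fun _ => mem_affineSubmodule_iff
  have hclosed : IsClosed (affineSubmodule μ B k : Set (Lp ℝ 2 (μ.restrict (B : Set V)))) :=
    hset ▸ isClosed_eq (gapOp μ B k).continuous continuous_id
  have := hclosed.completeSpace_coe
  exact .ofCompleteSpace _

end AffineSubmodule

/-! ### The unit ball -/

section UnitBall

/-- The unit ball `𝔹` as a symmetric convex body. -/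
abbrev unitBallBody (d : ℕ) : SymmConvexBody (Rd d) where
  carrier := unitBall d
  isCompact := isCompact_closedBall 0 1
  convex := convex_closedBall 0 1
  neg_mem_iff _ := neg_mem_unitBall
  interior_nonempty := ⟨0, Metric.ball_subset_interior_closedBall (Metric.mem_ball_self one_pos)⟩

theorem fourierInv_ballHat_pow (d k : ℕ) :
    𝓕⁻ (fun ξ => ballHat d ξ ^ (k + 2)) =
      fun x => (convPow volume (unitBallBody d) (k + 1) x : ℂ) :=
  fourierInv_fourier_indicator_pow (unitBallBody d).isCompact
    ((unitBallBody d).convex.addHaar_frontier volume) k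

variable {d k : ℕ} (hk : Even k)
include hk

theorem norm_ballHat_rpow (ξ : Rd d) :
    ((‖ballHat d ξ‖ ^ (((k + 4 : ℕ) : ℝ) - 2) : ℝ) : ℂ) = ballHat d ξ ^ (k + 2) := by
  have hre : ballHat d ξ = ((ballHat d ξ).re : ℂ) :=
    (Complex.conj_eq_iff_re.mp (conj_ballHat d ξ)).symm
  have hexp : ((k + 4 : ℕ) : ℝ) - 2 = ((k + 2 : ℕ) : ℝ) := by
    push_cast
    ring
  rw [hexp, Real.rpow_natCast, hre, Complex.norm_real, Real.norm_eq_abs,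
    (hk.add even_two).pow_abs, Complex.ofReal_pow]

theorem L_eq_convPow : L d ((k + 4 : ℕ) : ℝ) = convPow volume (unitBallBody d) (k + 1) := by
  have hhat : LHat d ((k + 4 : ℕ) : ℝ) = fun ξ => ballHat d ξ ^ (k + 2) :=
    funext (norm_ballHat_rpow hk)
  ext x
  rw [← Complex.ofReal_inj, ofReal_L, hhat, fourierInv_ballHat_pow]

theorem sqrt_K_eq_weight (x : Rd d) :
    √(K d ((k + 4 : ℕ) : ℝ) x) = weight volume (unitBallBody d) k x := by
  have hhat : KHat d ((k + 4 : ℕ) : ℝ) = fun ξ => ballHat d ξ ^ (k + 1 + 2) := by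
    ext ξ
    rw [KHat, norm_ballHat_rpow hk, pow_succ _ (k + 2)]
  have hK : K d ((k + 4 : ℕ) : ℝ) x = convPow volume (unitBallBody d) (k + 2) x := by
    rw [← Complex.ofReal_inj, ofReal_K, hhat, fourierInv_ballHat_pow]
  rw [hK, weight]

theorem TFun_eq_potential (h : Rd d → ℝ) : TFun d ((k + 4 : ℕ) : ℝ) h = fun x =>
    (weight volume (unitBallBody d) k x)⁻¹ * potential volume (unitBallBody d) k h x := by
  ext x
  simp only [TFun, potential, sqrt_K_eq_weight hk, L_eq_convPow hk]

theorem H_eq_affineSubmodule :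
    H d ((k + 4 : ℕ) : ℝ) = affineSubmodule volume (unitBallBody d) k := by
  ext h
  have hfun (p : Rd d × ℝ) : affineMap d ((k + 4 : ℕ) : ℝ) p =ᵐ[ballMeasure d] fun x =>
      weight volume (unitBallBody d) k x * (InnerProductSpace.toDual ℝ (Rd d) p.1 x + p.2) := by
    refine (memLp_affineFun d _ p).coeFn_toLp.trans (.of_eq (funext fun x => ?_))
    rw [affineFun, sqrt_K_eq_weight hk, InnerProductSpace.toDual_apply_apply]
  constructor
  · rintro ⟨p, rfl⟩
    exact ⟨_, _, hfun p⟩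
  · rintro ⟨a, b, hab⟩
    refine ⟨((InnerProductSpace.toDual ℝ (Rd d)).symm a, b), Lp.ext ((hfun _).trans ?_)⟩
    simp only [LinearIsometryEquiv.apply_symm_apply]
    exact hab.symm

end UnitBall

end BallSpectral

end

open BallSpectral in
theorem mainTheorem4_general {V : Type*} [NormedAddCommGroup V] [NormedSpace ℝ V]
    [FiniteDimensional ℝ V] [MeasurableSpace V] [BorelSpace V] (μ : Measure V)
    [μ.IsAddHaarMeasure] (B : SymmConvexBody V) (k : ℕ) :
    ∃ T : Lp ℝ 2 (μ.restrict (B : Set V)) →L[ℝ] Lp ℝ 2 (μ.restrict (B : Set V)),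
      (∀ h, T h =ᵐ[μ.restrict B] fun x => (weight μ B k x)⁻¹ * potential μ B k h x) ∧
      IsCompactOperator T ∧ IsSelfAdjoint T ∧
      ∃ c : ℝ, 0 < c ∧ ∀ h,
        -(((k + 4 : ℕ) : ℝ) / 2) * ‖h‖ ^ 2
            - (1 / 4 : ℝ) * (k + 4 : ℕ) * ((k + 4 : ℕ) - 2) * inner ℝ h (T (reflect μ B h))
            + (1 / 4 : ℝ) * ((k + 4 : ℕ) : ℝ) ^ 2 * inner ℝ h (T h)
          ≤ -c * ‖h - (affineSubmodule μ B k).starProjection h‖ ^ 2 := by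
  obtain ⟨c, hc, hgap⟩ := exists_gap_of_isCompactOperator (isCompactOperator_gapOp μ B k)
    (isPositive_one_sub_gapOp μ B k) fun _ => mem_affineSubmodule_iff
  refine ⟨convOp μ B k, convOp_ae_eq μ B, isCompactOperator_convOp μ B,
    (isSymmetric_convOp μ B).isSelfAdjoint, ((k + 4 : ℕ) : ℝ) / 2 * c, by positivity, fun h => ?_⟩
  have hq := mul_le_mul_of_nonneg_left (hgap h) (by positivity : (0 : ℝ) ≤ (k + 4 : ℕ) / 2)
  rw [gapOp, parityOp_apply, inner_sub_right, real_inner_self_eq_norm_sq, inner_add_right,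
    inner_smul_right, inner_smul_right] at hq
  push_cast at hq ⊢
  linarith

theorem mainTheorem4 (d : ℕ) (hd : 1 ≤ d) (q : ℕ) (hq : 4 ≤ q) (hq_even : Even q) :
    ∃ T : BallSpectral.L2Ball d →L[ℝ] BallSpectral.L2Ball d,
      BallSpectral.IsT d q T ∧ IsCompactOperator T ∧ IsSelfAdjoint T ∧
      ∃ c : ℝ, 0 < c ∧ ∀ h : BallSpectral.L2Ball d,
        -((q : ℝ) / 2) * ‖h‖ ^ 2
            - (1 / 4 : ℝ) * q * (q - 2) * BallSpectral.Q T h (BallSpectral.reflection d h)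
            + (1 / 4 : ℝ) * (q : ℝ) ^ 2 * BallSpectral.Q T h h
          ≤ -c * ‖h - (BallSpectral.H d q).starProjection h‖ ^ 2 := by
  obtain ⟨k, rfl⟩ := Nat.exists_eq_add_of_le' hq
  have hk : Even k := (Nat.even_add.mp hq_even).mpr (by decide)
  simp only [BallSpectral.IsT, BallSpectral.TFun_eq_potential hk,
    BallSpectral.H_eq_affineSubmodule hk]
  exact mainTheorem4_general volume (BallSpectral.unitBallBody d) k
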